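/- **Setting.** Let $X\in\mathbb{R}^{n\times p}$ be a fixed design, $g\in\mathbb{R}^n$ a mean vector (for instance $g=X\beta^0$), $\tau>0$, and $y\sim N(g,\tau^2 I_n)$. Let $A,B$ be non-empty disjoint sets with $A\cup B=\{1,\dots,n\}$ and sizes $n_A,n_B$. A selection algorithm $\hat M$ maps $y_A$ to a subset of $\{1,\dots,p\}$. Fix $M\subset\{1,\dots,p\}$ and $j\in M$ such that the Gram matrices $X_{A,M}^TX_{A,M}$ and $X_{B,M}^TX_{B,M}$ are invertible, and suppose that up to a Lebesgue null set $\{\hat M=M\}=\bigcup_s\{u\in\mathbb{R}^A: A_su\le b_s\}$, a finite or countable union of polyhedra. For $S\in\{A,B\}$ let $\eta_S^T$ be the row of $(X_{S,M}^TX_{S,M})^{-1}X_{S,M}^T$ belonging to $j$, and $\tau_S^2=\tau^2(X_{S,M}^TX_{S,M})^{-1}_{jj}$. Assume that both contrasts have the same mean $$\eta_A^Tg_A=\eta_B^Tg_B=:\beta_j^M$$ (true, for instance, if $g=X\beta^0$ and $M$ contains the support of $\beta^0$). The data carving estimator is $$\hat\beta_j=\tfrac1n\big[n_A\,\eta_A^Ty_A+n_B\,\eta_B^Ty_B\big].$$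 For a polyhedron $\{A_su\le b_s\}$ put $c=\eta_A/\|\eta_A\|^2$, $r(u)=u-c\,\eta_A^Tu$, $$V_s^-(u)=\max_{i:(A_sc)_i<0}\frac{(b_s-A_sr(u))_i}{(A_sc)_i},\qquad V_s^+(u)=\min_{i:(A_sc)_i>0}\frac{(b_s-A_sr(u))_i}{(A_sc)_i},$$ with $\max\emptyset=-\infty$ and $\min\emptyset=+\infty$. For $-\infty\le a<b\le+\infty$ and $\mu\in\mathbb{R}$ let $F_\mu^{a,b}$ be the CDF of the SNTN variable $\frac{n_B}{n}X_1+\frac{n_A}{n}X_2$, where $X_1\sim N(\mu,\tau_B^2)$ and $X_2$, which is $N(\mu,\tau_A^2)$ conditioned on $[a,b]$, are independent. **Theorem.** 1. *(The CDF.)* For all $a<b$, $\mu$ and $z$, with $\sigma_1^2=(n_B^2\tau_B^2+n_A^2\tau_A^2)/n^2$, $\sigma_2=\tau_A$, $\rho=n_A\sigma_2/(n\sigma_1)$, $\omega=(a-\mu)/\sigma_2$, $\delta=(b-\mu)/\sigma_2$, $$F_\mu^{a,b}(z)=\frac{B_\rho\big(\tfrac{z-\mu}{\sigma_1},\delta\big)-B_\rho\big(\tfrac{z-\mu}{\sigma_1},\omega\big)}{\Phi(\delta)-\Phi(\omega)},$$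 where $\Phi$ is the standard normal CDF and $B_\rho$ the CDF of the standard bivariate normal distribution with correlation $\rho$. 2. *(Monotonicity and unique roots.)* For all $a<b$ and $z$, the function $\mu\mapsto F_\mu^{a,b}(z)$ is strictly decreasing on $\mathbb{R}$, and for every $\alpha\in(0,1)$ the numbers $\sup\{\mu:F_\mu^{a,b}(z)\ge1-\alpha/2\}$ and $\inf\{\mu:F_\mu^{a,b}(z)\le\alpha/2\}$ are real and are the unique solutions $\mu$ of $F_\mu^{a,b}(z)=1-\alpha/2$ and $F_\mu^{a,b}(z)=\alpha/2$ respectively. 3. *(Exactness given the polyhedron.)* For every $s$ with $P(A_sy_A\le b_s)>0$, conditionally on $\{A_sy_A\le b_s\}$ and with $V^\pm=V_s^\pm(y_A)$: almost surely $V^-<V^+$; $$F_{\beta_j^M}^{V^-,V^+}(\hat\beta_j)\sim U(0,1);$$ and for every $\alpha\in(0,1)$ $$P\big(\beta_j^M\in[\hat\beta_j^-,\hat\beta_j^+]\big)=1-\alpha,\quad \hat\beta_j^-=\sup\{\mu:F_\mu^{V^-,V^+}(\hat\beta_j)\ge1-\alpha/2\},\quad \hat\beta_j^+=\inf\{\mu:F_\mu^{V^-,V^+}(\hat\beta_j)\le\alpha/2\}.$$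 4. *(Exactness given the selected model.)* If the polyhedra are pairwise disjoint up to null sets and $P(\hat M(y_A)=M)>0$, the same three assertions hold conditionally on $\{\hat M(y_A)=M\}$, with $V^\pm=V_{s}^\pm(y_A)$ for $s=\hat s(y_A)$ the index of a polyhedron that contains $y_A$. -/

import Mathlib

open MeasureTheory ProbabilityTheory
open scoped Matrix NNReal ENNReal

namespace Carving

noncomputable section

/-! ### The sum of a normal and a truncated normal -/

/-- The interval `{x ∈ ℝ : a ≤ x ≤ b}` with possibly infinite end points. -/
def eInterval (a b : EReal) : Set ℝ := {x : ℝ | a ≤ (x : EReal) ∧ (x : EReal) ≤ b}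

/-- `TN(μ, v, a, b)`: the law `N(μ, v)` conditioned on `[a, b]`. -/
def truncNormal (μ : ℝ) (v : ℝ≥0) (a b : EReal) : Measure ℝ :=
  cond (gaussianReal μ v) (eInterval a b)

/-- `SNTN(μ₁, v₁, μ₂, v₂, a, b, c₁, c₂)`: the law of `c₁ X₁ + c₂ X₂` for independent
`X₁ ∼ N(μ₁, v₁)` and `X₂ ∼ TN(μ₂, v₂, a, b)`. -/
def sntn (μ₁ : ℝ) (v₁ : ℝ≥0) (μ₂ : ℝ) (v₂ : ℝ≥0) (a b : EReal) (c₁ c₂ : ℝ) : Measure ℝ :=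
  ((gaussianReal μ₁ v₁).prod (truncNormal μ₂ v₂ a b)).map (fun q => c₁ * q.1 + c₂ * q.2)

/-- The cumulative distribution function of the SNTN distribution. -/
def sntnCDF (μ₁ : ℝ) (v₁ : ℝ≥0) (μ₂ : ℝ) (v₂ : ℝ≥0) (a b : EReal) (c₁ c₂ : ℝ) (z : ℝ) : ℝ :=
  (sntn μ₁ v₁ μ₂ v₂ a b c₁ c₂).real (Set.Iic z)

/-- The standard normal CDF `Φ`, extended to `±∞`. -/
def stdNormalCDF (x : EReal) : ℝ :=
  (gaussianReal 0 1).real {t : ℝ | (t : EReal) ≤ x}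

/-- The standard bivariate normal law with correlation `ρ`: the law of
`(ρ V + √(1 - ρ²) U, V)` for independent standard normal `U`, `V`. -/
def stdBivariateNormal (ρ : ℝ) : Measure (ℝ × ℝ) :=
  ((gaussianReal 0 1).prod (gaussianReal 0 1)).map
    (fun q => (ρ * q.2 + √(1 - ρ ^ 2) * q.1, q.2))

/-- The CDF `B_ρ(x₁, x₂)` of the standard bivariate normal law, with `x₂ = ±∞` allowed. -/
def bivariateNormalCDF (ρ x₁ : ℝ) (x₂ : EReal) : ℝ :=
  (stdBivariateNormal ρ).real {q : ℝ × ℝ | q.1 ≤ x₁ ∧ (q.2 : EReal) ≤ x₂}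

/-! ### Least squares on a part of the data -/

variable {n p : ℕ}

/-- `X_{S,M}`: the rows in `S` and the columns in `M` of the design matrix. -/
def subDesign (X : Matrix (Fin n) (Fin p) ℝ) (S : Finset (Fin n)) (M : Finset (Fin p)) :
    Matrix S M ℝ :=
  X.submatrix Subtype.val Subtype.val

/-- The Gram matrix `X_{S,M}ᵀ X_{S,M}`. -/
def gram (X : Matrix (Fin n) (Fin p) ℝ) (S : Finset (Fin n)) (M : Finset (Fin p)) :
    Matrix M M ℝ :=
  (subDesign X S M)ᵀ * subDesign X S M

/-- The contrast `η_{S,M_j}`: the row of `(X_{S,M}ᵀ X_{S,M})⁻¹ X_{S,M}ᵀ` that belongs to `j`. -/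
def contrast (X : Matrix (Fin n) (Fin p) ℝ) (S : Finset (Fin n)) (M : Finset (Fin p)) (j : M) :
    S → ℝ :=
  ((gram X S M)⁻¹ * (subDesign X S M)ᵀ) j

/-- `η_{S,M_j}ᵀ y_S`: the `j`-th coefficient in the regression of `y_S` on `X_{S,M}`. -/
def olsCoef (X : Matrix (Fin n) (Fin p) ℝ) (S : Finset (Fin n)) (M : Finset (Fin p)) (j : M)
    (y : Fin n → ℝ) : ℝ :=
  contrast X S M j ⬝ᵥ S.restrict y

/-- The data carving estimator `(n_A η_Aᵀ y_A + n_B η_Bᵀ y_B) / n`. -/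
def carveEstimator (X : Matrix (Fin n) (Fin p) ℝ) (SA SB : Finset (Fin n)) (M : Finset (Fin p))
    (j : M) (y : Fin n → ℝ) : ℝ :=
  ((SA.card : ℝ) * olsCoef X SA M j y + (SB.card : ℝ) * olsCoef X SB M j y) / (n : ℝ)

/-- The variance `τ² (X_{S,M}ᵀ X_{S,M})⁻¹_{jj}` of the `j`-th coefficient. -/
def coefVar (X : Matrix (Fin n) (Fin p) ℝ) (τ : ℝ) (S : Finset (Fin n)) (M : Finset (Fin p))
    (j : M) : ℝ :=
  τ ^ 2 * (gram X S M)⁻¹ j j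

/-- The SNTN CDF of data carving at the point `z`, as a function of the truncation points `a`, `b`
and of the common mean `μ` of the normal and the truncated normal component. -/
def carveCDF (X : Matrix (Fin n) (Fin p) ℝ) (τ : ℝ) (SA SB : Finset (Fin n))
    (M : Finset (Fin p)) (j : M) (a b : EReal) (μ z : ℝ) : ℝ :=
  sntnCDF μ (coefVar X τ SB M j).toNNReal μ (coefVar X τ SA M j).toNNReal a b
    ((SB.card : ℝ) / n) ((SA.card : ℝ) / n) z

/-! ### Polyhedral selection events and their truncation points -/

/-- The polyhedron `{u : A u ≤ b}`. -/
def polyhedron {S : Type*} [Fintype S] {m : ℕ} (A : Matrix (Fin m) S ℝ) (b : Fin m → ℝ) :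
    Set (S → ℝ) :=
  {u | ∀ i, (A *ᵥ u) i ≤ b i}

/-- The direction `c = η / ‖η‖²` along which `ηᵀ u` moves. -/
def direction {S : Type*} [Fintype S] (η : S → ℝ) : S → ℝ := (η ⬝ᵥ η)⁻¹ • η

/-- The component `u - c ηᵀ u` of `u` that is orthogonal to `η`. -/
def residual {S : Type*} [Fintype S] (η u : S → ℝ) : S → ℝ := u - (η ⬝ᵥ u) • direction η

/-- `V⁻(u) = max_{i : (A c)_i < 0} (b_i - (A r)_i) / (A c)_i` with `r` the residual of `u`;
it is `-∞` if there is no such `i`. -/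
def truncLower {S : Type*} [Fintype S] {m : ℕ} (η : S → ℝ) (A : Matrix (Fin m) S ℝ)
    (b : Fin m → ℝ) (u : S → ℝ) : EReal :=
  ⨆ (i : Fin m) (_ : (A *ᵥ direction η) i < 0),
    (((b i - (A *ᵥ residual η u) i) / (A *ᵥ direction η) i : ℝ) : EReal)

/-- `V⁺(u) = min_{i : (A c)_i > 0} (b_i - (A r)_i) / (A c)_i` with `r` the residual of `u`;
it is `+∞` if there is no such `i`. -/
def truncUpper {S : Type*} [Fintype S] {m : ℕ} (η : S → ℝ) (A : Matrix (Fin m) S ℝ)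
    (b : Fin m → ℝ) (u : S → ℝ) : EReal :=
  ⨅ (i : Fin m) (_ : 0 < (A *ᵥ direction η) i),
    (((b i - (A *ᵥ residual η u) i) / (A *ᵥ direction η) i : ℝ) : EReal)

/-! ### Confidence intervals and exactness -/

/-- `sup {μ : G μ ≥ 1 - α/2}`. -/
def ciLower (G : ℝ → ℝ) (α : ℝ) : ℝ := sSup {μ : ℝ | 1 - α / 2 ≤ G μ}

/-- `inf {μ : G μ ≤ α/2}`. -/
def ciUpper (G : ℝ → ℝ) (α : ℝ) : ℝ := sInf {μ : ℝ | G μ ≤ α / 2}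

/-- Exact inference for `β` under the (conditional) probability law `Q`, based on the estimator `T`
and the random truncation points `lo`, `up`; here `F a b μ z` is the CDF at `z` for the truncation
points `a`, `b` and the mean `μ`. -/
structure ExactInference {Ω : Type*} [MeasurableSpace Ω] (Q : Measure Ω)
    (F : EReal → EReal → ℝ → ℝ → ℝ) (T : Ω → ℝ) (lo up : Ω → EReal) (β : ℝ) : Prop where
  /-- Almost surely the truncation interval is not degenerate. -/
  lower_lt_upper : ∀ᵐ ω ∂Q, lo ω < up ω
  /-- The p-value at the true parameter is uniform on `(0, 1)`. -/
  uniform : pdf.IsUniform (fun ω => F (lo ω) (up ω) β (T ω)) (Set.Ioo 0 1) Q volume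
  /-- The confidence interval of level `1 - α` covers `β` with probability exactly `1 - α`. -/
  coverage : ∀ α ∈ Set.Ioo (0 : ℝ) 1,
    Q {ω | β ∈ Set.Icc (ciLower (fun μ => F (lo ω) (up ω) μ (T ω)) α)
      (ciUpper (fun μ => F (lo ω) (up ω) μ (T ω)) α)} = ENNReal.ofReal (1 - α)

end

end Carving

namespace Carving

open Filter Topology

/-! ### Gaussian measures of intervals -/

/-! Write `y_A = r + c ηᵀy_A`, with `r` the part of `y_A` orthogonal to `η = η_A`. Each inequality
of a polyhedron is then affine in the number `ηᵀy_A`, with coefficients depending on `r` only: the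
polyhedron says that `r` obeys the constraints insensitive to `η` and that `V⁻(r) ≤ ηᵀy_A ≤ V⁺(r)`
(`mem_polyhedron_iff`). The residual `r`, the contrast of `y_A` and the contrast of `y_B` are
independent: the first two are jointly Gaussian and uncorrelated, the third uses other coordinates
(`hasLaw_carveTriple`).

So on almost every fibre `r` the truncation points are constants, and the estimator given the event
is a normal plus an independent truncated normal variable, with the same mean parameter. This law
has no atoms, hence its distribution function at the estimator is uniform. Since the uniform law is
the same on every fibre, integrating over `r` keeps it (`map_sntnCDF_restrict_prod`); for the same
reason a countable union of almost disjoint polyhedra keeps it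
(`map_restrict_eq_smul_of_ae_eq_iUnion`).

The confidence interval comes from inverting the distribution function in the mean `μ`. Truncated
normals of fixed variance form an exponential family: moving the mean multiplies the density by a
monotone exponential, so by Chebyshev's inequality they increase stochastically
(`integral_truncNormal_anti`). The untruncated summand makes the decrease of the CDF strict;
continuity and the limits 1 and 0 follow by dominated convergence. Coverage of the true parameter
thus means that the uniform p-value lies in `[α/2, 1 - α/2]`, an interval of length `1 - α`.

The bivariate normal formula is a standardisation of the two summands. -/

lemma measurableSet_eInterval (a b : EReal) : MeasurableSet (eInterval a b) :=
  measurable_coe_real_ereal measurableSet_Icc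

lemma gaussianReal_eInterval_ne_zero (μ : ℝ) {v : ℝ≥0} (hv : v ≠ 0) {a b : EReal} (hab : a < b) :
    gaussianReal μ v (eInterval a b) ≠ 0 := by
  obtain ⟨x, hax, hxb⟩ := EReal.lt_iff_exists_real_btwn.1 hab
  obtain ⟨y, hxy, hyb⟩ := EReal.lt_iff_exists_real_btwn.1 hxb
  have hxy' : x < y := EReal.coe_lt_coe_iff.1 hxy
  have hsub : Set.Ioo x y ⊆ eInterval a b := fun t ht =>
    ⟨hax.le.trans (EReal.coe_le_coe_iff.2 ht.1.le), (EReal.coe_le_coe_iff.2 ht.2.le).trans hyb.le⟩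
  intro h
  have h0 := gaussianReal_absolutelyContinuous' μ hv (measure_mono_null hsub h)
  simp at h0
  linarith

/-- At most one point satisfies both bounds. This disposes of degenerate truncation intervals
everywhere below. -/
lemma gaussianReal_eInterval_eq_zero (μ : ℝ) {v : ℝ≥0} (hv : v ≠ 0) {a b : EReal} (hab : b ≤ a) :
    gaussianReal μ v (eInterval a b) = 0 := by
  have := nullSingletonClass_gaussianReal (μ := μ) hv
  refine Set.Subsingleton.measure_zero (fun x hx y hy => ?_) _
  exact le_antisymm (EReal.coe_le_coe_iff.1 ((hx.2.trans hab).trans hy.1))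
    (EReal.coe_le_coe_iff.1 ((hy.2.trans hab).trans hx.1))

lemma isProbabilityMeasure_truncNormal (μ : ℝ) {v : ℝ≥0} (hv : v ≠ 0) {a b : EReal}
    (hab : a < b) : IsProbabilityMeasure (truncNormal μ v a b) :=
  cond_isProbabilityMeasure (gaussianReal_eInterval_ne_zero μ hv hab)

instance isFiniteMeasure_truncNormal (μ : ℝ) (v : ℝ≥0) (a b : EReal) :
    IsFiniteMeasure (truncNormal μ v a b) := by
  rcases lt_or_ge a b with _ | _ <;> (unfold truncNormal; infer_instance)

lemma isProbabilityMeasure_sntn (μ₁ : ℝ) (v₁ : ℝ≥0) (μ₂ : ℝ) {v₂ : ℝ≥0} (hv₂ : v₂ ≠ 0)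
    {a b : EReal} (hab : a < b) (c₁ c₂ : ℝ) :
    IsProbabilityMeasure (sntn μ₁ v₁ μ₂ v₂ a b c₁ c₂) := by
  have := isProbabilityMeasure_truncNormal μ₂ hv₂ hab
  unfold sntn
  exact Measure.isProbabilityMeasure_map (by fun_prop)

/-- The distribution function of the centred normal law with variance `v`. -/
noncomputable def centredCDF (v : ℝ≥0) (t : ℝ) : ℝ := (gaussianReal 0 v).real (Set.Iic t)

lemma centredCDF_eq_cdf (v : ℝ≥0) : centredCDF v = cdf (gaussianReal 0 v) := by
  ext t; rw [cdf_eq_real]; rfl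

lemma centredCDF_nonneg (v : ℝ≥0) (t : ℝ) : 0 ≤ centredCDF v t := measureReal_nonneg

lemma centredCDF_le_one (v : ℝ≥0) (t : ℝ) : centredCDF v t ≤ 1 := measureReal_le_one

lemma monotone_centredCDF (v : ℝ≥0) : Monotone (centredCDF v) := by
  rw [centredCDF_eq_cdf]; exact monotone_cdf _

lemma strictMono_centredCDF {v : ℝ≥0} (hv : v ≠ 0) : StrictMono (centredCDF v) := by
  intro s t hst
  have hpos : 0 < (gaussianReal 0 v).real (Set.Ioc s t) := by
    refine (measureReal_nonneg).lt_of_ne' fun h => ?_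
    rw [measureReal_eq_zero_iff] at h
    have h0 := gaussianReal_absolutelyContinuous' 0 hv h
    simp at h0
    linarith
  have hdec : centredCDF v t = centredCDF v s + (gaussianReal 0 v).real (Set.Ioc s t) := by
    unfold centredCDF
    rw [← measureReal_union (Set.Iic_disjoint_Ioc le_rfl) measurableSet_Ioc,
      Set.Iic_union_Ioc_eq_Iic hst.le]
  linarith

/-- The jump of a distribution function at `x` is the mass of `{x}`. -/
lemma continuous_cdf_of_nullSingleton (ν : Measure ℝ) [IsProbabilityMeasure ν]
    (hν : ∀ x, ν {x} = 0) : Continuous (cdf ν) := by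
  refine continuous_iff_continuousAt.2 fun x => ?_
  have h := (cdf ν).measure_singleton x
  rw [measure_cdf, hν, eq_comm, ENNReal.ofReal_eq_zero] at h
  have hle := (monotone_cdf ν).leftLim_le (le_refl x)
  refine (monotone_cdf ν).continuousAt_iff_leftLim_eq_rightLim.2 ?_
  rw [(cdf ν).rightLim_eq]
  linarith

lemma continuous_centredCDF {v : ℝ≥0} (hv : v ≠ 0) : Continuous (centredCDF v) := by
  have := nullSingletonClass_gaussianReal (μ := 0) hv
  rw [centredCDF_eq_cdf]
  exact continuous_cdf_of_nullSingleton _ fun x => measure_singleton x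

lemma gaussianReal_real_setOf_le {v : ℝ≥0} {c₁ : ℝ} (hc₁ : 0 < c₁) (μ k z : ℝ) :
    (gaussianReal μ v).real {x | c₁ * x + k ≤ z} = centredCDF v ((z - k) / c₁ - μ) := by
  have hμ : (gaussianReal 0 v).map (· + μ) = gaussianReal μ v := by
    rw [gaussianReal_map_add_const, zero_add]
  rw [← hμ, map_measureReal_apply (by fun_prop)
    (measurableSet_le (by fun_prop) (by fun_prop)), centredCDF]
  congr 1
  ext x
  simp only [Set.mem_preimage, Set.mem_ofPred_eq, Set.mem_Iic]
  rw [le_sub_iff_add_le, le_div_iff₀ hc₁]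
  constructor <;> intro h <;> linarith

/-! ### The distribution function as an average over the truncated component -/

/-- Fubini, conditioning on the truncated component: all dependence on the truncation sits in the
integrating measure. -/
lemma sntnCDF_eq_integral {v₁ : ℝ≥0} {c₁ : ℝ} (hc₁ : 0 < c₁)
    (μ₁ μ₂ : ℝ) (v₂ : ℝ≥0) (a b : EReal) (c₂ z : ℝ) :
    sntnCDF μ₁ v₁ μ₂ v₂ a b c₁ c₂ z =
      ∫ x, centredCDF v₁ ((z - c₂ * x) / c₁ - μ₁) ∂(truncNormal μ₂ v₂ a b) := by
  have hs : MeasurableSet ((fun q : ℝ × ℝ => c₁ * q.1 + c₂ * q.2) ⁻¹' Set.Iic z) :=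
    (by fun_prop : Measurable (fun q : ℝ × ℝ => c₁ * q.1 + c₂ * q.2)) measurableSet_Iic
  rw [sntnCDF, sntn, map_measureReal_apply (by fun_prop) measurableSet_Iic, Measure.real,
    Measure.prod_apply_symm hs, ← integral_toReal
      (measurable_measure_prodMk_right hs).aemeasurable (ae_of_all _ fun _ => measure_lt_top _ _)]
  congr 1
  ext x
  rw [← gaussianReal_real_setOf_le hc₁]
  rfl

lemma sntn_singleton {v₁ : ℝ≥0} (hv₁ : v₁ ≠ 0) {c₁ : ℝ} (hc₁ : 0 < c₁)
    (μ₁ μ₂ : ℝ) (v₂ : ℝ≥0) (a b : EReal) (c₂ z : ℝ) :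
    sntn μ₁ v₁ μ₂ v₂ a b c₁ c₂ {z} = 0 := by
  have := nullSingletonClass_gaussianReal (μ := μ₁) hv₁
  have hs : MeasurableSet ((fun q : ℝ × ℝ => c₁ * q.1 + c₂ * q.2) ⁻¹' {z}) :=
    (by fun_prop : Measurable (fun q : ℝ × ℝ => c₁ * q.1 + c₂ * q.2)) (measurableSet_singleton z)
  rw [sntn, Measure.map_apply (by fun_prop) (measurableSet_singleton z),
    Measure.prod_apply_symm hs]
  refine lintegral_eq_zero_of_ae_eq_zero (ae_of_all _ fun x => ?_)
  refine Set.Subsingleton.measure_zero (fun s hs t ht => ?_) _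
  simp only [Set.mem_preimage, Set.mem_singleton_iff] at hs ht
  exact mul_left_cancel₀ hc₁.ne' (by linarith)

lemma sntnCDF_eq_cdf (μ₁ : ℝ) (v₁ : ℝ≥0) (μ₂ : ℝ) {v₂ : ℝ≥0} (hv₂ : v₂ ≠ 0)
    {a b : EReal} (hab : a < b) (c₁ c₂ z : ℝ) :
    sntnCDF μ₁ v₁ μ₂ v₂ a b c₁ c₂ z = cdf (sntn μ₁ v₁ μ₂ v₂ a b c₁ c₂) z := by
  have := isProbabilityMeasure_sntn μ₁ v₁ μ₂ hv₂ hab c₁ c₂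
  rw [cdf_eq_real]; rfl

/-! ### The probability integral transform -/

/-- The CDF may be flat somewhere, so no inverse is used. If `cdf ν x = t`, then `{cdf < t} ⊆ Iic x
⊆ {cdf ≤ t}`, which bounds the two masses by `t` from above and below; continuity supplies such an
`x`. -/
lemma map_cdf_eq_volume_restrict (ν : Measure ℝ) [IsProbabilityMeasure ν]
    (hν : ∀ x, ν {x} = 0) : ν.map (cdf ν) = (volume : Measure ℝ).restrict (Set.Ioo 0 1) := by
  have hcont := continuous_cdf_of_nullSingleton ν hν
  have hmeas : Measurable (cdf ν) := hcont.measurable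
  have : IsProbabilityMeasure (ν.map (cdf ν)) := Measure.isProbabilityMeasure_map hmeas.aemeasurable
  have : IsProbabilityMeasure ((volume : Measure ℝ).restrict (Set.Ioo 0 1)) := ⟨by simp⟩
  have hsurj : ∀ t ∈ Set.Ioo (0 : ℝ) 1, ∃ x, cdf ν x = t := fun t ht =>
    mem_range_of_exists_le_of_exists_ge hcont
      (((tendsto_cdf_atBot ν).eventually (gt_mem_nhds ht.1)).exists.imp fun _ h => h.le)
      (((tendsto_cdf_atTop ν).eventually (lt_mem_nhds ht.2)).exists.imp fun _ h => h.le)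
  have hlow : ∀ t ∈ Set.Ioo (0 : ℝ) 1, t ≤ ν.real {x | cdf ν x ≤ t} := fun t ht => by
    obtain ⟨x, hx⟩ := hsurj t ht
    calc t = ν.real (Set.Iic x) := by rw [← hx, cdf_eq_real]
      _ ≤ _ := measureReal_mono fun y hy => ((monotone_cdf ν) hy).trans hx.le
  have hup : ∀ t ∈ Set.Ioo (0 : ℝ) 1, ν.real {x | cdf ν x < t} ≤ t := fun t ht => by
    obtain ⟨x, hx⟩ := hsurj t ht
    calc ν.real {x | cdf ν x < t} ≤ ν.real (Set.Iic x) :=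
          measureReal_mono fun y hy => by
            by_contra h
            exact absurd ((monotone_cdf ν) (not_le.1 h).le) (not_le.2 (hx ▸ hy))
      _ = t := by rw [← hx, cdf_eq_real]
  have hIoo : ∀ t : ℝ, 0 ≤ t → t ≤ 1 →
      ((volume : Measure ℝ).restrict (Set.Ioo 0 1)).real (Set.Iic t) = t := fun t h0 h1 => by
    rw [measureReal_restrict_apply measurableSet_Iic]
    rcases h1.lt_or_eq with h1 | rfl
    · rw [show Set.Iic t ∩ Set.Ioo 0 1 = Set.Ioc 0 t by
        ext x; simp only [Set.mem_inter_iff, Set.mem_Iic, Set.mem_Ioo, Set.mem_Ioc]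
        constructor
        · rintro ⟨h, h', -⟩; exact ⟨h', h⟩
        · rintro ⟨h, h'⟩; exact ⟨h', h, h'.trans_lt h1⟩]
      simp [h0]
    · rw [Set.inter_eq_self_of_subset_right fun x hx => hx.2.le]
      simp
  refine Measure.eq_of_cdf _ _ ?_
  ext t
  rw [cdf_eq_real, cdf_eq_real, map_measureReal_apply hmeas measurableSet_Iic]
  change ν.real {x | cdf ν x ≤ t} = _
  rcases le_or_gt t 0 with h0 | h0
  · have hr : ((volume : Measure ℝ).restrict (Set.Ioo 0 1)).real (Set.Iic t) = 0 := by
      rw [measureReal_restrict_apply measurableSet_Iic, show Set.Iic t ∩ Set.Ioo (0 : ℝ) 1 = ∅ by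
        ext x; simp only [Set.mem_inter_iff, Set.mem_Iic, Set.mem_Ioo, Set.mem_empty_iff_false,
          iff_false]; rintro ⟨h, h', -⟩; linarith]
      simp
    rw [hr]
    -- The upper bound holds for strict sublevel sets only, so it is applied at every `s > t`, using
    -- `{cdf ≤ t} ⊆ {cdf < s}`.
    refine le_antisymm (le_of_forall_gt_imp_ge_of_dense fun s hs => ?_) measureReal_nonneg
    rcases lt_or_ge s 1 with hs1 | hs1
    · exact (measureReal_mono fun x (hx : cdf ν x ≤ t) =>
        show cdf ν x < s by linarith).trans (hup s ⟨hs, hs1⟩)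
    · exact measureReal_le_one.trans hs1
  · rcases lt_or_ge t 1 with h1 | h1
    · rw [hIoo t h0.le h1.le]
      refine le_antisymm (le_of_forall_gt_imp_ge_of_dense fun s hs => ?_) (hlow t ⟨h0, h1⟩)
      rcases lt_or_ge s 1 with hs1 | hs1
      · exact (measureReal_mono fun x (hx : cdf ν x ≤ t) =>
          show cdf ν x < s by linarith).trans (hup s ⟨by linarith, hs1⟩)
      · exact measureReal_le_one.trans hs1
    · have e1 : {x | cdf ν x ≤ t} = Set.univ := by
        ext x; simp [(cdf_le_one ν x).trans h1]
      have hr : ((volume : Measure ℝ).restrict (Set.Ioo 0 1)).real (Set.Iic t) = 1 := by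
        rw [measureReal_restrict_apply measurableSet_Iic,
          Set.inter_eq_self_of_subset_right
            (show Set.Ioo (0 : ℝ) 1 ⊆ Set.Iic t from fun x hx => hx.2.le.trans h1)]
        simp
      rw [e1, hr]; simp

lemma map_sntnCDF_sntn {v₁ : ℝ≥0} (hv₁ : v₁ ≠ 0) {v₂ : ℝ≥0} (hv₂ : v₂ ≠ 0) {a b : EReal}
    (hab : a < b) {c₁ : ℝ} (hc₁ : 0 < c₁) (c₂ μ₁ μ₂ : ℝ) :
    (sntn μ₁ v₁ μ₂ v₂ a b c₁ c₂).map (sntnCDF μ₁ v₁ μ₂ v₂ a b c₁ c₂) =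
      (volume : Measure ℝ).restrict (Set.Ioo 0 1) := by
  have := isProbabilityMeasure_sntn μ₁ v₁ μ₂ hv₂ hab c₁ c₂
  rw [funext (sntnCDF_eq_cdf μ₁ v₁ μ₂ hv₂ hab c₁ c₂)]
  exact map_cdf_eq_volume_restrict _ (sntn_singleton hv₁ hc₁ μ₁ μ₂ v₂ a b c₂)

/-! ### Exponential tilting of truncated normal laws -/

/-- With equal variances the quadratic terms in `x` cancel in the ratio of the two densities. -/
lemma withDensity_exp_gaussianReal (μ ν : ℝ) {v : ℝ≥0} (hv : v ≠ 0) :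
    (gaussianReal μ v).withDensity (fun x => ENNReal.ofReal
      (Real.exp (-((ν ^ 2 - μ ^ 2) / (2 * v))) * Real.exp ((ν - μ) / v * x))) =
      gaussianReal ν v := by
  rw [gaussianReal_of_var_ne_zero _ hv, gaussianReal_of_var_ne_zero _ hv,
    ← withDensity_mul _ (measurable_gaussianPDF _ _) (by fun_prop)]
  congr 1
  ext x
  have hv' : (v : ℝ) ≠ 0 := NNReal.coe_ne_zero.2 hv
  simp only [Pi.mul_apply, gaussianPDF]
  rw [← ENNReal.ofReal_mul (gaussianPDFReal_nonneg _ _ _)]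
  simp only [gaussianPDFReal]
  rw [mul_assoc, ← Real.exp_add, ← Real.exp_add]
  congr 3
  field_simp
  ring

lemma setIntegral_gaussianReal_tilt (μ ν : ℝ) {v : ℝ≥0} (hv : v ≠ 0) {s : Set ℝ}
    (hs : MeasurableSet s) (f : ℝ → ℝ) :
    ∫ x in s, f x ∂(gaussianReal ν v) = Real.exp (-((ν ^ 2 - μ ^ 2) / (2 * v))) *
      ∫ x in s, f x * Real.exp ((ν - μ) / v * x) ∂(gaussianReal μ v) := by
  rw [← withDensity_exp_gaussianReal μ ν hv, restrict_withDensity hs,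
    integral_withDensity_eq_integral_toReal_smul (by fun_prop)
      (ae_of_all _ fun _ => ENNReal.ofReal_lt_top), ← integral_const_mul]
  congr 1
  ext x
  rw [ENNReal.toReal_ofReal (by positivity), smul_eq_mul]
  ring

lemma integral_truncNormal (μ : ℝ) (v : ℝ≥0) (a b : EReal) (f : ℝ → ℝ) :
    ∫ x, f x ∂(truncNormal μ v a b) = ((gaussianReal μ v).real (eInterval a b))⁻¹ *
      ∫ x in eInterval a b, f x ∂(gaussianReal μ v) := by
  rw [truncNormal, ProbabilityTheory.cond, integral_smul_measure, ENNReal.toReal_inv, smul_eq_mul]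
  rfl

/-- Both the constant of the tilt and the normalisation of the truncation cancel in the quotient.
Every mean `ν` is thereby expressed through one reference law. -/
lemma integral_truncNormal_tilt (μ ν : ℝ) {v : ℝ≥0} (hv : v ≠ 0) {a b : EReal} (hab : a < b)
    (f : ℝ → ℝ) :
    ∫ x, f x ∂(truncNormal ν v a b) =
      (∫ x, f x * Real.exp ((ν - μ) / v * x) ∂(truncNormal μ v a b)) /
        ∫ x, Real.exp ((ν - μ) / v * x) ∂(truncNormal μ v a b) := by
  have hD : (gaussianReal ν v).real (eInterval a b) = Real.exp (-((ν ^ 2 - μ ^ 2) / (2 * v))) *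
      ∫ x in eInterval a b, Real.exp ((ν - μ) / v * x) ∂(gaussianReal μ v) := by
    simpa using setIntegral_gaussianReal_tilt μ ν hv (measurableSet_eInterval a b) (fun _ => 1)
  have hμ : (gaussianReal μ v).real (eInterval a b) ≠ 0 := by
    rw [ne_eq, measureReal_eq_zero_iff]; exact gaussianReal_eInterval_ne_zero μ hv hab
  rw [integral_truncNormal, integral_truncNormal, integral_truncNormal, hD,
    setIntegral_gaussianReal_tilt μ ν hv (measurableSet_eInterval a b) f, mul_inv,
    mul_mul_mul_comm, inv_mul_cancel₀ (Real.exp_ne_zero _), one_mul,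
    mul_div_mul_left _ _ (inv_ne_zero hμ), ← div_eq_inv_mul]

lemma integrable_exp_truncNormal (μ : ℝ) {v : ℝ≥0} (hv : v ≠ 0) {a b : EReal} (hab : a < b)
    (t : ℝ) : Integrable (fun x => Real.exp (t * x)) (truncNormal μ v a b) :=
  ((integrable_exp_mul_gaussianReal t).integrableOn).smul_measure
    (ENNReal.inv_ne_top.2 (gaussianReal_eInterval_ne_zero μ hv hab))

/-! ### Stochastic monotonicity -/

/-- Chebyshev's integral inequality for an antitone and a monotone function. -/
lemma integral_mul_le_mul_integral_of_antitone {ν : Measure ℝ} [IsProbabilityMeasure ν]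
    {f g : ℝ → ℝ} (hf : Antitone f) (hg : Monotone g) (hfi : Integrable f ν)
    (hgi : Integrable g ν) (hfg : Integrable (fun x => f x * g x) ν) :
    ∫ x, f x * g x ∂ν ≤ (∫ x, f x ∂ν) * ∫ x, g x ∂ν := by
  -- Symmetrisation with two independent copies: the factors have opposite signs pointwise, and
  -- expanding the product gives twice the difference of the two sides.
  have hle : ∫ q, (f q.1 - f q.2) * (g q.1 - g q.2) ∂(ν.prod ν) ≤ 0 := by
    refine integral_nonpos fun q => ?_
    rcases le_total q.1 q.2 with h | h
    · exact mul_nonpos_of_nonneg_of_nonpos (sub_nonneg.2 (hf h)) (sub_nonpos.2 (hg h))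
    · exact mul_nonpos_of_nonpos_of_nonneg (sub_nonpos.2 (hf h)) (sub_nonneg.2 (hg h))
  have i1 := hfg.comp_fst ν
  have i2 := hfg.comp_snd ν
  have i3 := hfi.mul_prod (ν := ν) hgi
  have i4 := hgi.mul_prod (ν := ν) hfi
  have heq : ∫ q, (f q.1 - f q.2) * (g q.1 - g q.2) ∂(ν.prod ν) =
      2 * (∫ x, f x * g x ∂ν) - 2 * ((∫ x, f x ∂ν) * ∫ x, g x ∂ν) := by
    calc _ = ∫ q, ((f q.1 * g q.1 + f q.2 * g q.2) - (f q.1 * g q.2 + g q.1 * f q.2))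
          ∂(ν.prod ν) := by congr 1; ext q; ring
      _ = _ := by
        rw [integral_sub (by exact i1.add i2) (by exact i3.add i4), integral_add i1 i2,
          integral_add i3 i4, integral_fun_fst (fun x => f x * g x),
          integral_fun_snd (fun x => f x * g x),
          integral_prod_mul, integral_prod_mul]
        simp
        ring
  linarith

/-- The likelihood ratio of a larger to a smaller mean is increasing, so an antitone `f` is
negatively correlated with it. -/
lemma integral_truncNormal_anti {v : ℝ≥0} (hv : v ≠ 0) {a b : EReal} (hab : a < b)
    {f : ℝ → ℝ} (hf : Antitone f) (hfC : ∀ x, ‖f x‖ ≤ 1) :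
    Antitone fun μ => ∫ x, f x ∂(truncNormal μ v a b) := by
  intro μ ν hμν
  have := isProbabilityMeasure_truncNormal μ hv hab
  have hfm : AEStronglyMeasurable f (truncNormal μ v a b) := hf.measurable.aestronglyMeasurable
  have hexp := integrable_exp_truncNormal μ hv hab ((ν - μ) / v)
  have ht : 0 ≤ (ν - μ) / v := div_nonneg (sub_nonneg.2 hμν) v.coe_nonneg
  simp only
  rw [integral_truncNormal_tilt μ ν hv hab, div_le_iff₀ (integral_exp_pos hexp)]
  refine integral_mul_le_mul_integral_of_antitone hf
    (fun x y hxy => Real.exp_le_exp.2 (mul_le_mul_of_nonneg_left hxy ht))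
    (Integrable.of_bound hfm 1 (ae_of_all _ hfC)) hexp
    (hexp.bdd_mul hfm (ae_of_all _ hfC))

/-! ### The distribution function as a function of the mean -/

/-- The conditional distribution function of `c₁ X₁ + c₂ X₂` at `z` given `X₂ = x`. -/
noncomputable def sectionCDF (v₁ : ℝ≥0) (c₁ c₂ z μ x : ℝ) : ℝ :=
  centredCDF v₁ ((z - c₂ * x) / c₁ - μ)

section Mean

variable {v₁ v₂ : ℝ≥0} {c₁ c₂ : ℝ} {a b : EReal}

lemma norm_sectionCDF_le (z μ x : ℝ) : ‖sectionCDF v₁ c₁ c₂ z μ x‖ ≤ 1 := by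
  rw [sectionCDF, Real.norm_of_nonneg (centredCDF_nonneg _ _)]
  exact centredCDF_le_one _ _

lemma antitone_sectionCDF (hc₁ : 0 < c₁) (hc₂ : 0 ≤ c₂) (z μ : ℝ) :
    Antitone (sectionCDF v₁ c₁ c₂ z μ) := by
  intro x y hxy
  refine monotone_centredCDF _ ?_
  gcongr

lemma integrable_sectionCDF (hc₁ : 0 < c₁) (hc₂ : 0 ≤ c₂) (z μ : ℝ) (ν : Measure ℝ)
    [IsFiniteMeasure ν] : Integrable (sectionCDF v₁ c₁ c₂ z μ) ν :=
  Integrable.of_bound (antitone_sectionCDF hc₁ hc₂ z μ).measurable.aestronglyMeasurable 1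
    (ae_of_all _ (norm_sectionCDF_le z μ))

/-- The mean acts in two places. Raising it in the untruncated component lowers the integrand
strictly at every point; raising it in the truncated component lowers the integral weakly, because
the integrand is antitone for `c₂ ≥ 0`. -/
lemma sntnCDF_strictAnti (hv₁ : v₁ ≠ 0) (hv₂ : v₂ ≠ 0) (hc₁ : 0 < c₁) (hc₂ : 0 ≤ c₂)
    (hab : a < b) (z : ℝ) : StrictAnti fun μ => sntnCDF μ v₁ μ v₂ a b c₁ c₂ z := by
  intro μ ν hμν
  have := isProbabilityMeasure_truncNormal ν hv₂ hab
  simp only [sntnCDF_eq_integral hc₁]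
  refine lt_of_lt_of_le ?_ (integral_truncNormal_anti hv₂ hab
    (antitone_sectionCDF hc₁ hc₂ z μ) (norm_sectionCDF_le z μ) hμν.le)
  have hlt : ∀ x, sectionCDF v₁ c₁ c₂ z ν x < sectionCDF v₁ c₁ c₂ z μ x := fun x =>
    strictMono_centredCDF hv₁ (by linarith)
  have i1 := integrable_sectionCDF (v₁ := v₁) hc₁ hc₂ z ν (truncNormal ν v₂ a b)
  have i2 := integrable_sectionCDF (v₁ := v₁) hc₁ hc₂ z μ (truncNormal ν v₂ a b)
  rw [← sub_pos]
  change 0 < (∫ x, sectionCDF v₁ c₁ c₂ z μ x ∂_) - ∫ x, sectionCDF v₁ c₁ c₂ z ν x ∂_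
  rw [← integral_sub i2 i1, integral_pos_iff_support_of_nonneg
    (fun x => sub_nonneg.2 (hlt x).le) (i2.sub i1)]
  have hsupp : Function.support (fun x => sectionCDF v₁ c₁ c₂ z μ x - sectionCDF v₁ c₁ c₂ z ν x) =
      Set.univ := Set.eq_univ_of_forall fun x => (sub_pos.2 (hlt x)).ne'
  rw [hsupp, measure_univ]
  exact one_pos

lemma continuous_sntnCDF_mean (hv₁ : v₁ ≠ 0) (hv₂ : v₂ ≠ 0) (hc₁ : 0 < c₁) (hc₂ : 0 ≤ c₂)
    (hab : a < b) (z : ℝ) : Continuous fun μ => sntnCDF μ v₁ μ v₂ a b c₁ c₂ z := by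
  have := isProbabilityMeasure_truncNormal 0 hv₂ hab
  have hexpm : ∀ t : ℝ, Measurable fun x : ℝ => Real.exp (t * x) := fun t => by fun_prop
  -- After tilting to the reference mean 0, the measure no longer depends on `μ`. Numerator and
  -- denominator of the quotient are both of this form.
  have key : ∀ F : ℝ → ℝ → ℝ, (∀ μ, Measurable (F μ)) → (∀ μ x, ‖F μ x‖ ≤ 1) →
      (∀ x, Continuous fun μ => F μ x) →
      Continuous fun μ => ∫ x, F μ x * Real.exp ((μ - 0) / v₂ * x) ∂(truncNormal 0 v₂ a b) := by
    intro F hm hC hc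
    refine continuous_iff_continuousAt.2 fun μ₀ => ?_
    -- For `|μ - μ₀| < 1` the exponent is at most `(|μ₀| + 1) / v₂ * |x|`; the sum of the
    -- exponentials of both signs dominates and is integrable.
    refine continuousAt_of_dominated (bound := fun x => Real.exp ((|μ₀| + 1) / v₂ * x) +
      Real.exp (-((|μ₀| + 1) / v₂) * x)) ?_ ?_
      ((integrable_exp_truncNormal 0 hv₂ hab _).add (integrable_exp_truncNormal 0 hv₂ hab _)) ?_
    · exact Eventually.of_forall fun μ => ((hm μ).mul (hexpm _)).aestronglyMeasurable
    · filter_upwards [Metric.ball_mem_nhds μ₀ one_pos] with μ hμ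
      refine ae_of_all _ fun x => ?_
      have hμ' : |μ| ≤ |μ₀| + 1 := by
        rw [Metric.mem_ball, Real.dist_eq] at hμ
        have := abs_sub_abs_le_abs_sub μ μ₀
        linarith
      have hx : (μ - 0) / v₂ * x ≤ (|μ₀| + 1) / v₂ * |x| := by
        calc (μ - 0) / v₂ * x ≤ |(μ - 0) / v₂ * x| := le_abs_self _
          _ = |μ| / v₂ * |x| := by rw [abs_mul, abs_div, sub_zero, NNReal.abs_eq]
          _ ≤ _ := by gcongr
      calc ‖F μ x * Real.exp ((μ - 0) / v₂ * x)‖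
          ≤ 1 * Real.exp ((μ - 0) / v₂ * x) := by
            rw [norm_mul, Real.norm_of_nonneg (Real.exp_nonneg _)]
            exact mul_le_mul_of_nonneg_right (hC μ x) (Real.exp_nonneg _)
        _ ≤ Real.exp ((|μ₀| + 1) / v₂ * |x|) := by rw [one_mul]; exact Real.exp_le_exp.2 hx
        _ ≤ _ := by
          rcases abs_cases x with ⟨h, -⟩ | ⟨h, -⟩ <;> rw [h]
          · exact le_add_of_nonneg_right (Real.exp_nonneg _)
          · rw [mul_neg, ← neg_mul]; exact le_add_of_nonneg_left (Real.exp_nonneg _)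
    · refine ae_of_all _ fun x => ((hc x).mul ?_).continuousAt
      fun_prop
  have hN := key (fun μ x => sectionCDF v₁ c₁ c₂ z μ x)
    (fun μ => (antitone_sectionCDF hc₁ hc₂ z μ).measurable) (norm_sectionCDF_le z)
    (fun x => (continuous_centredCDF hv₁).comp (by fun_prop))
  have hD := key (fun _ _ => 1) (fun _ => measurable_const) (fun _ _ => by simp)
    (fun _ => continuous_const)
  simp only [one_mul] at hD
  have hEq : (fun μ => sntnCDF μ v₁ μ v₂ a b c₁ c₂ z) = fun μ =>
      (∫ x, sectionCDF v₁ c₁ c₂ z μ x * Real.exp ((μ - 0) / v₂ * x) ∂(truncNormal 0 v₂ a b)) /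
        ∫ x, Real.exp ((μ - 0) / v₂ * x) ∂(truncNormal 0 v₂ a b) := by
    ext μ
    rw [sntnCDF_eq_integral hc₁]
    exact integral_truncNormal_tilt 0 μ hv₂ hab _
  rw [hEq]
  exact hN.div hD fun μ => (integral_exp_pos (integrable_exp_truncNormal 0 hv₂ hab _)).ne'

lemma tendsto_integral_sectionCDF (hc₁ : 0 < c₁) (hc₂ : 0 ≤ c₂) (z : ℝ) (ν : Measure ℝ)
    [IsProbabilityMeasure ν] {l : Filter ℝ} [l.IsCountablyGenerated] {k : ℝ}
    (hl : ∀ y, Tendsto (fun μ => centredCDF v₁ (y - μ)) l (𝓝 k)) :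
    Tendsto (fun μ => ∫ x, sectionCDF v₁ c₁ c₂ z μ x ∂ν) l (𝓝 k) := by
  have := tendsto_integral_filter_of_dominated_convergence (μ := ν) (l := l)
    (F := fun μ x => sectionCDF v₁ c₁ c₂ z μ x) (f := fun _ => k) (fun _ => 1)
    (Eventually.of_forall fun μ =>
      (antitone_sectionCDF hc₁ hc₂ z μ).measurable.aestronglyMeasurable)
    (Eventually.of_forall fun μ => ae_of_all _ (norm_sectionCDF_le z μ))
    (integrable_const 1) (ae_of_all _ fun x => hl _)
  simpa using this

/-- For `μ ≥ 0`, replacing the truncated law of mean `μ` by that of mean 0 can only increase the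
integral. Against this fixed law dominated convergence applies, and the CDF is squeezed to 0. -/
lemma tendsto_sntnCDF_mean_atTop (hv₂ : v₂ ≠ 0) (hc₁ : 0 < c₁) (hc₂ : 0 ≤ c₂)
    (hab : a < b) (z : ℝ) : Tendsto (fun μ => sntnCDF μ v₁ μ v₂ a b c₁ c₂ z) atTop (𝓝 0) := by
  have := isProbabilityMeasure_truncNormal 0 hv₂ hab
  refine tendsto_of_tendsto_of_tendsto_of_le_of_le' tendsto_const_nhds
    (tendsto_integral_sectionCDF hc₁ hc₂ z (truncNormal 0 v₂ a b) (v₁ := v₁) (l := atTop) ?_)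
    (Eventually.of_forall fun μ => measureReal_nonneg) ?_
  · intro y
    rw [centredCDF_eq_cdf]
    exact (tendsto_cdf_atBot _).comp
      (tendsto_atBot_add_const_left _ y tendsto_neg_atTop_atBot)
  · filter_upwards [eventually_ge_atTop 0] with μ hμ
    rw [sntnCDF_eq_integral hc₁]
    exact integral_truncNormal_anti hv₂ hab
      (antitone_sectionCDF hc₁ hc₂ z μ) (norm_sectionCDF_le z μ) hμ

lemma tendsto_sntnCDF_mean_atBot (hv₂ : v₂ ≠ 0) (hc₁ : 0 < c₁) (hc₂ : 0 ≤ c₂)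
    (hab : a < b) (z : ℝ) : Tendsto (fun μ => sntnCDF μ v₁ μ v₂ a b c₁ c₂ z) atBot (𝓝 1) := by
  have := isProbabilityMeasure_truncNormal 0 hv₂ hab
  refine tendsto_of_tendsto_of_tendsto_of_le_of_le'
    (tendsto_integral_sectionCDF hc₁ hc₂ z (truncNormal 0 v₂ a b) (v₁ := v₁) (l := atBot) ?_)
    tendsto_const_nhds ?_ (Eventually.of_forall fun μ => ?_)
  · intro y
    rw [centredCDF_eq_cdf]
    exact (tendsto_cdf_atTop _).comp
      (tendsto_atTop_add_const_left _ y tendsto_neg_atBot_atTop)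
  · filter_upwards [eventually_le_atBot 0] with μ hμ
    rw [sntnCDF_eq_integral hc₁]
    exact integral_truncNormal_anti hv₂ hab
      (antitone_sectionCDF hc₁ hc₂ z μ) (norm_sectionCDF_le z μ) hμ
  · have := isProbabilityMeasure_sntn μ v₁ μ hv₂ hab c₁ c₂
    exact measureReal_le_one

end Mean

/-! ### Roots of a decreasing family of distribution functions -/

section Roots

variable {G : ℝ → ℝ} {α : ℝ}

lemma exists_eq_of_tendsto (hc : Continuous G) (hbot : Tendsto G atBot (𝓝 1))
    (htop : Tendsto G atTop (𝓝 0)) {t : ℝ} (ht : t ∈ Set.Ioo (0 : ℝ) 1) : ∃ μ, G μ = t :=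
  mem_range_of_exists_le_of_exists_ge hc
    ((htop.eventually (gt_mem_nhds ht.1)).exists.imp fun _ h => h.le)
    ((hbot.eventually (lt_mem_nhds ht.2)).exists.imp fun _ h => h.le)

/-- The set under the supremum is exactly `Iic μ`, so the default value of `sSup` never enters. -/
lemma ciLower_eq (hG : StrictAnti G) {μ : ℝ} (h : G μ = 1 - α / 2) : ciLower G α = μ := by
  have : {ν : ℝ | 1 - α / 2 ≤ G ν} = Set.Iic μ := by
    ext ν; rw [Set.mem_ofPred_eq, ← h, hG.le_iff_ge, Set.mem_Iic]
  rw [ciLower, this, csSup_Iic]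

lemma ciUpper_eq (hG : StrictAnti G) {μ : ℝ} (h : G μ = α / 2) : ciUpper G α = μ := by
  have : {ν : ℝ | G ν ≤ α / 2} = Set.Ici μ := by
    ext ν; rw [Set.mem_ofPred_eq, ← h, hG.le_iff_ge, Set.mem_Ici]
  rw [ciUpper, this, csInf_Ici]

lemma map_ciLower (hG : StrictAnti G) (hc : Continuous G) (hbot : Tendsto G atBot (𝓝 1))
    (htop : Tendsto G atTop (𝓝 0)) (hα : α ∈ Set.Ioo (0 : ℝ) 1) :
    G (ciLower G α) = 1 - α / 2 := by
  obtain ⟨μ, hμ⟩ := exists_eq_of_tendsto hc hbot htop (t := 1 - α / 2)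
    ⟨by linarith [hα.2], by linarith [hα.1]⟩
  rwa [ciLower_eq hG hμ]

lemma map_ciUpper (hG : StrictAnti G) (hc : Continuous G) (hbot : Tendsto G atBot (𝓝 1))
    (htop : Tendsto G atTop (𝓝 0)) (hα : α ∈ Set.Ioo (0 : ℝ) 1) :
    G (ciUpper G α) = α / 2 := by
  obtain ⟨μ, hμ⟩ := exists_eq_of_tendsto hc hbot htop (t := α / 2)
    ⟨by linarith [hα.1], by linarith [hα.2]⟩
  rwa [ciUpper_eq hG hμ]

lemma mem_Icc_ci_iff (hG : StrictAnti G) (hc : Continuous G) (hbot : Tendsto G atBot (𝓝 1))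
    (htop : Tendsto G atTop (𝓝 0)) (hα : α ∈ Set.Ioo (0 : ℝ) 1) (μ : ℝ) :
    μ ∈ Set.Icc (ciLower G α) (ciUpper G α) ↔ G μ ∈ Set.Icc (α / 2) (1 - α / 2) := by
  rw [Set.mem_Icc, Set.mem_Icc, ← hG.le_iff_ge (a := μ), ← hG.le_iff_ge (b := μ),
    map_ciLower hG hc hbot htop hα, map_ciUpper hG hc hbot htop hα, and_comm]

end Roots

/-! ### The distribution function through the bivariate normal law -/

/-- For a null interval both sides are 0 by the convention for inverses. The absence of a condition
on `a` and `b` gives joint measurability in the truncation points. -/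
lemma sntnCDF_eq_div (μ₁ μ₂ : ℝ) (v₁ v₂ : ℝ≥0) (a b : EReal) (c₁ c₂ z : ℝ) :
    sntnCDF μ₁ v₁ μ₂ v₂ a b c₁ c₂ z =
      ((gaussianReal μ₁ v₁).prod (gaussianReal μ₂ v₂)).real
        {q | c₁ * q.1 + c₂ * q.2 ≤ z ∧ q.2 ∈ eInterval a b} /
      (gaussianReal μ₂ v₂).real (eInterval a b) := by
  have hs : MeasurableSet ((fun q : ℝ × ℝ => c₁ * q.1 + c₂ * q.2) ⁻¹' Set.Iic z) :=
    (by fun_prop : Measurable (fun q : ℝ × ℝ => c₁ * q.1 + c₂ * q.2)) measurableSet_Iic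
  have hprod : (gaussianReal μ₁ v₁).prod ((gaussianReal μ₂ v₂).restrict (eInterval a b)) =
      ((gaussianReal μ₁ v₁).prod (gaussianReal μ₂ v₂)).restrict
        (Set.univ ×ˢ eInterval a b) := by
    rw [← Measure.prod_restrict, Measure.restrict_univ]
  rw [sntnCDF, sntn, map_measureReal_apply (by fun_prop) measurableSet_Iic, truncNormal,
    ProbabilityTheory.cond, Measure.prod_smul_right, measureReal_ennreal_smul_apply, hprod,
    measureReal_restrict_apply hs, ENNReal.toReal_inv, div_eq_inv_mul]
  congr 2
  ext q
  simp

lemma map_gaussianReal_std {V : ℝ} (hV : 0 ≤ V) (μ : ℝ) :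
    (gaussianReal 0 1).map (fun x => √V * x + μ) = gaussianReal μ V.toNNReal := by
  have : (fun x : ℝ => √V * x + μ) = (· + μ) ∘ (√V * ·) := rfl
  rw [this, ← Measure.map_map (by fun_prop) (by fun_prop), gaussianReal_map_const_mul,
    gaussianReal_map_add_const]
  congr 1
  · simp
  · ext; simp [Real.sq_sqrt hV, hV]

lemma le_coe_affine_iff {s : ℝ} (hs : 0 < s) (μ x : ℝ) (a : EReal) :
    a ≤ ((s * x + μ : ℝ) : EReal) ↔ (a - (μ : EReal)) / (s : EReal) ≤ (x : EReal) := by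
  induction a with
  | bot => simp [EReal.bot_div_of_pos_ne_top (EReal.coe_pos.2 hs) (EReal.coe_ne_top s)]
  | top =>
    rw [EReal.top_sub_coe, EReal.top_div_of_pos_ne_top (EReal.coe_pos.2 hs) (EReal.coe_ne_top s),
      top_le_iff, top_le_iff]
    exact iff_of_false (EReal.coe_ne_top _) (EReal.coe_ne_top _)
  | coe a =>
    rw [← EReal.coe_sub, ← EReal.coe_div, EReal.coe_le_coe_iff, EReal.coe_le_coe_iff,
      div_le_iff₀ hs, sub_le_iff_le_add, mul_comm]

lemma coe_affine_le_iff {s : ℝ} (hs : 0 < s) (μ x : ℝ) (b : EReal) :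
    ((s * x + μ : ℝ) : EReal) ≤ b ↔ (x : EReal) ≤ (b - (μ : EReal)) / (s : EReal) := by
  induction b with
  | bot =>
    rw [EReal.bot_sub, EReal.bot_div_of_pos_ne_top (EReal.coe_pos.2 hs) (EReal.coe_ne_top s),
      le_bot_iff, le_bot_iff]
    exact iff_of_false (EReal.coe_ne_bot _) (EReal.coe_ne_bot _)
  | top => simp [EReal.top_div_of_pos_ne_top (EReal.coe_pos.2 hs) (EReal.coe_ne_top s)]
  | coe b =>
    rw [← EReal.coe_sub, ← EReal.coe_div, EReal.coe_le_coe_iff, EReal.coe_le_coe_iff,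
      le_div_iff₀ hs, le_sub_iff_add_le, mul_comm]

/-- A difference of distribution functions gives a half-open interval; the null hypothesis on `f =
w` closes it. -/
lemma measureReal_le_sub_measureReal_le {α : Type*} [MeasurableSpace α] (κ : Measure α)
    [IsFiniteMeasure κ] {E : Set α} (hE : MeasurableSet E) {f : α → EReal} (hf : Measurable f)
    {w d : EReal} (hwd : w ≤ d) (hw : κ {q | f q = w} = 0) :
    κ.real {q | q ∈ E ∧ f q ≤ d} - κ.real {q | q ∈ E ∧ f q ≤ w} =
      κ.real {q | q ∈ E ∧ w ≤ f q ∧ f q ≤ d} := by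
  have hm : MeasurableSet {q | q ∈ E ∧ f q ≤ w} := hE.inter (hf measurableSet_Iic)
  have hsub : {q | q ∈ E ∧ f q ≤ w} ⊆ {q | q ∈ E ∧ f q ≤ d} :=
    fun q hq => ⟨hq.1, hq.2.trans hwd⟩
  rw [← measureReal_sdiff hsub hm]
  refine measureReal_congr ?_
  have hne : ∀ᵐ q ∂κ, f q ≠ w := by rw [ae_iff]; simpa using hw
  filter_upwards [hne] with q hq
  refine propext ?_
  change (q ∈ E ∧ f q ≤ d) ∧ ¬ (q ∈ E ∧ f q ≤ w) ↔ q ∈ E ∧ w ≤ f q ∧ f q ≤ d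
  constructor
  · rintro ⟨⟨h1, h2⟩, h3⟩
    exact ⟨h1, (not_le.1 fun h => h3 ⟨h1, h⟩).le, h2⟩
  · rintro ⟨h1, h2, h3⟩
    exact ⟨⟨h1, h3⟩, fun h => hq (le_antisymm h.2 h2)⟩

/-- With `X₁ = μ + √V₁ U` and `X₂ = μ + √V₂ V`, the untruncated sum, centred and divided by `σ₁`,
equals `ρ V + √(1 - ρ²) U`, since `1 - ρ² = c₁² V₁ / σ₁²`. Its correlation with `V` is `ρ`, and
truncating `X₂` truncates `V`. -/
lemma sntnCDF_eq_bivariateNormalCDF {V₁ V₂ c₁ c₂ : ℝ} (hV₁ : 0 < V₁) (hV₂ : 0 < V₂) (hc₁ : 0 < c₁)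
    {a b : EReal} (hab : a < b) (μ z : ℝ) {σ₁ ρ : ℝ}
    (hσ₁ : σ₁ = √(c₁ ^ 2 * V₁ + c₂ ^ 2 * V₂)) (hρ : ρ = c₂ * √V₂ / σ₁) :
    sntnCDF μ V₁.toNNReal μ V₂.toNNReal a b c₁ c₂ z =
      (bivariateNormalCDF ρ ((z - μ * (c₁ + c₂)) / σ₁) ((b - (μ : EReal)) / (√V₂ : EReal))
        - bivariateNormalCDF ρ ((z - μ * (c₁ + c₂)) / σ₁) ((a - (μ : EReal)) / (√V₂ : EReal)))
      / (stdNormalCDF ((b - (μ : EReal)) / (√V₂ : EReal))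
        - stdNormalCDF ((a - (μ : EReal)) / (√V₂ : EReal))) := by
  set w : EReal := (a - (μ : EReal)) / (√V₂ : EReal) with hw
  set d : EReal := (b - (μ : EReal)) / (√V₂ : EReal) with hd
  have hs₂ : 0 < √V₂ := Real.sqrt_pos.2 hV₂
  have hS : 0 < c₁ ^ 2 * V₁ + c₂ ^ 2 * V₂ := by positivity
  have hσpos : 0 < σ₁ := hσ₁ ▸ Real.sqrt_pos.2 hS
  have hσsq : σ₁ ^ 2 = c₁ ^ 2 * V₁ + c₂ ^ 2 * V₂ := by rw [hσ₁, Real.sq_sqrt hS.le]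
  have hrho : √(1 - ρ ^ 2) = c₁ * √V₁ / σ₁ := by
    rw [Real.sqrt_eq_iff_eq_sq (by
      rw [hρ, div_pow, mul_pow, Real.sq_sqrt hV₂.le, hσsq, sub_nonneg, div_le_one hS]
      have := mul_pos (pow_pos hc₁ 2) hV₁
      linarith) (by positivity)]
    rw [hρ, div_pow, div_pow, mul_pow, mul_pow, Real.sq_sqrt hV₂.le, Real.sq_sqrt hV₁.le, hσsq]
    field_simp
    ring
  have hnull := nullSingletonClass_gaussianReal (μ := 0) (one_ne_zero (α := ℝ≥0))
  have hwd : w ≤ d := by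
    obtain ⟨x, hax, hxb⟩ := EReal.lt_iff_exists_real_btwn.1 hab
    -- A real point between `a` and `b`, once standardised, separates `w` from `d`, also when these
    -- are infinite.
    have hx : √V₂ * ((x - μ) / √V₂) + μ = x := by field_simp; ring
    refine ((le_coe_affine_iff hs₂ μ ((x - μ) / √V₂) a).1 ?_).trans
      ((coe_affine_le_iff hs₂ μ ((x - μ) / √V₂) b).1 ?_)
    · rw [hx]; exact hax.le
    · rw [hx]; exact hxb.le
  have hsingle : gaussianReal 0 1 {t : ℝ | (t : EReal) = w} = 0 :=
    Set.Subsingleton.measure_zero (fun x hx y hy => EReal.coe_injective (hx.trans hy.symm)) _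
  have hcoe : Measurable fun t : ℝ => (t : EReal) := measurable_coe_real_ereal
  have hden : stdNormalCDF d - stdNormalCDF w =
      (gaussianReal μ V₂.toNNReal).real (eInterval a b) := by
    have h := measureReal_le_sub_measureReal_le (gaussianReal 0 1) MeasurableSet.univ hcoe hwd
      hsingle
    rw [← map_gaussianReal_std hV₂.le, map_measureReal_apply (by fun_prop)
      (measurableSet_eInterval a b)]
    simp only [Set.mem_univ, true_and] at h
    rw [stdNormalCDF, stdNormalCDF, h]
    congr 1
    ext x
    exact ((le_coe_affine_iff hs₂ μ x a).and (coe_affine_le_iff hs₂ μ x b)).symm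
  have hlin : Measurable fun q : ℝ × ℝ => (ρ * q.2 + √(1 - ρ ^ 2) * q.1, q.2) := by fun_prop
  have hB : ∀ x : EReal, bivariateNormalCDF ρ ((z - μ * (c₁ + c₂)) / σ₁) x =
      ((gaussianReal 0 1).prod (gaussianReal 0 1)).real
        {q | q ∈ {q : ℝ × ℝ | ρ * q.2 + √(1 - ρ ^ 2) * q.1 ≤ (z - μ * (c₁ + c₂)) / σ₁} ∧
          (q.2 : EReal) ≤ x} := fun x => by
    rw [bivariateNormalCDF, stdBivariateNormal, map_measureReal_apply hlin]
    · rfl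
    · exact (measurableSet_le measurable_fst measurable_const).inter
        ((hcoe.comp measurable_snd) measurableSet_Iic)
  have hnum : bivariateNormalCDF ρ ((z - μ * (c₁ + c₂)) / σ₁) d -
        bivariateNormalCDF ρ ((z - μ * (c₁ + c₂)) / σ₁) w =
      ((gaussianReal μ V₁.toNNReal).prod (gaussianReal μ V₂.toNNReal)).real
        {q | c₁ * q.1 + c₂ * q.2 ≤ z ∧ q.2 ∈ eInterval a b} := by
    have hn2 : ((gaussianReal 0 1).prod (gaussianReal 0 1))
        {q : ℝ × ℝ | (q.2 : EReal) = w} = 0 := by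
      have : {q : ℝ × ℝ | (q.2 : EReal) = w} = Set.univ ×ˢ {t : ℝ | (t : EReal) = w} := by
        ext q; simp
      rw [this, Measure.prod_prod, hsingle, mul_zero]
    have hE : MeasurableSet
        {q : ℝ × ℝ | ρ * q.2 + √(1 - ρ ^ 2) * q.1 ≤ (z - μ * (c₁ + c₂)) / σ₁} :=
      measurableSet_le (by fun_prop) measurable_const
    rw [hB, hB, measureReal_le_sub_measureReal_le (f := fun q : ℝ × ℝ => (q.2 : EReal)) _ hE
        (hcoe.comp measurable_snd) hwd hn2,
      ← map_gaussianReal_std hV₁.le, ← map_gaussianReal_std hV₂.le,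
      Measure.map_prod_map _ _ (by fun_prop) (by fun_prop), map_measureReal_apply (by fun_prop)]
    · congr 1
      ext q
      have e1 : ρ * q.2 + √(1 - ρ ^ 2) * q.1 ≤ (z - μ * (c₁ + c₂)) / σ₁ ↔
          c₁ * (√V₁ * q.1 + μ) + c₂ * (√V₂ * q.2 + μ) ≤ z := by
        rw [le_div_iff₀ hσpos, hrho, hρ]
        have : (c₂ * √V₂ / σ₁ * q.2 + c₁ * √V₁ / σ₁ * q.1) * σ₁ =
            c₂ * √V₂ * q.2 + c₁ * √V₁ * q.1 := by field_simp
        rw [this]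
        constructor <;> intro h <;> linarith
      exact e1.and ((le_coe_affine_iff hs₂ μ q.2 a).and (coe_affine_le_iff hs₂ μ q.2 b)).symm
    · have hE' : MeasurableSet {q : ℝ × ℝ | c₁ * q.1 + c₂ * q.2 ≤ z} :=
        measurableSet_le (by fun_prop) measurable_const
      exact hE'.inter (measurable_snd (measurableSet_eInterval a b))
  rw [hnum, hden, sntnCDF_eq_div]

/-- The distribution function is jointly measurable in the truncation points and the argument. -/
lemma measurable_sntnCDF (μ₁ μ₂ : ℝ) (v₁ v₂ : ℝ≥0) (c₁ c₂ : ℝ) :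
    Measurable fun q : EReal × EReal × ℝ => sntnCDF μ₁ v₁ μ₂ v₂ q.1 q.2.1 c₁ c₂ q.2.2 := by
  have hcoe : Measurable fun t : ℝ => (t : EReal) := measurable_coe_real_ereal
  simp only [sntnCDF_eq_div]
  refine Measurable.div ?_ ?_
  · have h₁ : MeasurableSet {x : (EReal × EReal × ℝ) × (ℝ × ℝ) |
        c₁ * x.2.1 + c₂ * x.2.2 ≤ x.1.2.2} := measurableSet_le (by fun_prop) (by fun_prop)
    have h₂ : MeasurableSet {x : (EReal × EReal × ℝ) × (ℝ × ℝ) | x.1.1 ≤ (x.2.2 : EReal)} :=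
      measurableSet_le (by fun_prop) (by fun_prop)
    have h₃ : MeasurableSet {x : (EReal × EReal × ℝ) × (ℝ × ℝ) | (x.2.2 : EReal) ≤ x.1.2.1} :=
      measurableSet_le (by fun_prop) (by fun_prop)
    exact (measurable_measure_prodMk_left (ν := (gaussianReal μ₁ v₁).prod (gaussianReal μ₂ v₂))
      (h₁.inter (h₂.inter h₃))).ennreal_toReal
  · have h₂ : MeasurableSet {x : (EReal × EReal × ℝ) × ℝ | x.1.1 ≤ (x.2 : EReal)} :=
      measurableSet_le (by fun_prop) (by fun_prop)
    have h₃ : MeasurableSet {x : (EReal × EReal × ℝ) × ℝ | (x.2 : EReal) ≤ x.1.2.1} :=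
      measurableSet_le (by fun_prop) (by fun_prop)
    exact (measurable_measure_prodMk_left (ν := gaussianReal μ₂ v₂) (h₂.inter h₃)).ennreal_toReal

/-! ### Uniformity of the p-value on a truncation event -/

lemma measurable_sntnCDF_comp {α : Type*} [MeasurableSpace α] {lo up : α → EReal} {T : α → ℝ}
    (hlo : Measurable lo) (hup : Measurable up) (hT : Measurable T) (μ₁ μ₂ : ℝ) (v₁ v₂ : ℝ≥0)
    (c₁ c₂ : ℝ) : Measurable fun x => sntnCDF μ₁ v₁ μ₂ v₂ (lo x) (up x) c₁ c₂ (T x) := by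
  have h := (measurable_sntnCDF μ₁ μ₂ v₁ v₂ c₁ c₂).comp (hlo.prodMk (hup.prodMk hT))
  simpa only [Function.comp_def] using h

/-- The probability integral transform with the normalising constant multiplied out. In this form it
also holds, as `0 = 0`, for degenerate intervals, so it can be integrated over random truncation
points. -/
lemma prod_gaussianReal_sntnCDF_mem {v₁ v₂ : ℝ≥0} (hv₁ : v₁ ≠ 0) (hv₂ : v₂ ≠ 0) {c₁ : ℝ}
    (hc₁ : 0 < c₁) (c₂ μ₁ μ₂ : ℝ) (a b : EReal) {S : Set ℝ} (hS : MeasurableSet S) :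
    ((gaussianReal μ₁ v₁).prod (gaussianReal μ₂ v₂))
        {q | sntnCDF μ₁ v₁ μ₂ v₂ a b c₁ c₂ (c₁ * q.1 + c₂ * q.2) ∈ S ∧ q.2 ∈ eInterval a b} =
      gaussianReal μ₂ v₂ (eInterval a b) * (volume : Measure ℝ).restrict (Set.Ioo 0 1) S := by
  rcases lt_or_ge a b with hab | hab
  · have hF : Measurable (sntnCDF μ₁ v₁ μ₂ v₂ a b c₁ c₂) :=
      measurable_sntnCDF_comp measurable_const measurable_const measurable_id μ₁ μ₂ v₁ v₂ c₁ c₂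
    have hlin : Measurable fun q : ℝ × ℝ => c₁ * q.1 + c₂ * q.2 := by fun_prop
    have h0 := gaussianReal_eInterval_ne_zero μ₂ hv₂ hab
    rw [← map_sntnCDF_sntn hv₁ hv₂ hab hc₁ c₂ μ₁ μ₂, Measure.map_apply hF hS, sntn,
      Measure.map_apply hlin (hF hS), truncNormal, ProbabilityTheory.cond,
      Measure.prod_smul_right, Measure.smul_apply, smul_eq_mul, ← mul_assoc,
      ENNReal.mul_inv_cancel h0 (measure_ne_top _ _), one_mul]
    have hprod : (gaussianReal μ₁ v₁).prod ((gaussianReal μ₂ v₂).restrict (eInterval a b)) =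
        ((gaussianReal μ₁ v₁).prod (gaussianReal μ₂ v₂)).restrict
          (Set.univ ×ˢ eInterval a b) := by
      rw [← Measure.prod_restrict, Measure.restrict_univ]
    rw [hprod, Measure.restrict_apply (hlin (hF hS))]
    congr 1
    ext q
    simp
  · have h0 := gaussianReal_eInterval_eq_zero μ₂ hv₂ hab
    rw [h0, zero_mul]
    refine measure_mono_null (t := Set.univ ×ˢ eInterval a b) (fun q hq => ⟨trivial, hq.2⟩) ?_
    rw [Measure.prod_prod, h0, mul_zero]

section Core

variable {E : Type*} [MeasurableSpace E] {ν : Measure E} {v₁ v₂ : ℝ≥0} {c₁ : ℝ}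
  {lo up : E → EReal} {D : Set E}

lemma measurableSet_truncEvent (hlo : Measurable lo) (hup : Measurable up) (hD : MeasurableSet D) :
    MeasurableSet {x : E × ℝ × ℝ | x.1 ∈ D ∧ x.2.2 ∈ eInterval (lo x.1) (up x.1)} := by
  have h₂ : MeasurableSet {x : E × ℝ × ℝ | lo x.1 ≤ (x.2.2 : EReal)} :=
    measurableSet_le (by fun_prop) (by fun_prop)
  have h₃ : MeasurableSet {x : E × ℝ × ℝ | (x.2.2 : EReal) ≤ up x.1} :=
    measurableSet_le (by fun_prop) (by fun_prop)
  exact (measurable_fst hD).inter (h₂.inter h₃)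

/-- On the fibre over `r` the truncation points are fixed, and the mass factors into the weight of
the interval times the uniform mass of `S`. The second factor does not depend on `r`. -/
lemma map_sntnCDF_restrict_prod (hv₁ : v₁ ≠ 0) (hv₂ : v₂ ≠ 0) (hc₁ : 0 < c₁) (c₂ μ₁ μ₂ : ℝ)
    (hlo : Measurable lo) (hup : Measurable up) (hD : MeasurableSet D) :
    ((ν.prod ((gaussianReal μ₁ v₁).prod (gaussianReal μ₂ v₂))).restrict
        {x | x.1 ∈ D ∧ x.2.2 ∈ eInterval (lo x.1) (up x.1)}).map
      (fun x => sntnCDF μ₁ v₁ μ₂ v₂ (lo x.1) (up x.1) c₁ c₂ (c₁ * x.2.1 + c₂ * x.2.2)) =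
    (ν.prod ((gaussianReal μ₁ v₁).prod (gaussianReal μ₂ v₂)))
        {x | x.1 ∈ D ∧ x.2.2 ∈ eInterval (lo x.1) (up x.1)} •
      (volume : Measure ℝ).restrict (Set.Ioo 0 1) := by
  have hT := measurableSet_truncEvent hlo hup hD
  have hlin : Measurable fun x : E × ℝ × ℝ => c₁ * x.2.1 + c₂ * x.2.2 := by fun_prop
  have hf := measurable_sntnCDF_comp (hlo.comp (measurable_fst (β := ℝ × ℝ)))
    (hup.comp measurable_fst) hlin μ₁ μ₂ v₁ v₂ c₁ c₂
  simp only [Function.comp_apply] at hf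
  have hsec : ∀ {S : Set ℝ}, MeasurableSet S → ∀ r : E,
      ((gaussianReal μ₁ v₁).prod (gaussianReal μ₂ v₂))
        (Prod.mk r ⁻¹' ((fun x : E × ℝ × ℝ => sntnCDF μ₁ v₁ μ₂ v₂ (lo x.1) (up x.1) c₁ c₂
          (c₁ * x.2.1 + c₂ * x.2.2)) ⁻¹' S ∩
          {x | x.1 ∈ D ∧ x.2.2 ∈ eInterval (lo x.1) (up x.1)})) =
      D.indicator (fun r => gaussianReal μ₂ v₂ (eInterval (lo r) (up r))) r *
        (volume : Measure ℝ).restrict (Set.Ioo 0 1) S := by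
    intro S hS r
    by_cases hr : r ∈ D
    · rw [Set.indicator_of_mem hr,
        ← prod_gaussianReal_sntnCDF_mem hv₁ hv₂ hc₁ c₂ μ₁ μ₂ _ _ hS]
      congr 1
      ext q
      simp [hr]
    · rw [Set.indicator_of_notMem hr, zero_mul]
      convert measure_empty (μ := (gaussianReal μ₁ v₁).prod (gaussianReal μ₂ v₂))
      ext q
      simp [hr]
  have hmeas : Measurable (D.indicator fun r => gaussianReal μ₂ v₂ (eInterval (lo r) (up r))) := by
    refine Measurable.indicator ?_ hD
    have h₂ : MeasurableSet {x : E × ℝ | lo x.1 ≤ (x.2 : EReal)} :=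
      measurableSet_le (by fun_prop) (by fun_prop)
    have h₃ : MeasurableSet {x : E × ℝ | (x.2 : EReal) ≤ up x.1} :=
      measurableSet_le (by fun_prop) (by fun_prop)
    exact measurable_measure_prodMk_left (h₂.inter h₃)
  have hval : ∀ {S : Set ℝ}, MeasurableSet S →
      (ν.prod ((gaussianReal μ₁ v₁).prod (gaussianReal μ₂ v₂)))
        ((fun x : E × ℝ × ℝ => sntnCDF μ₁ v₁ μ₂ v₂ (lo x.1) (up x.1) c₁ c₂
          (c₁ * x.2.1 + c₂ * x.2.2)) ⁻¹' S ∩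
          {x | x.1 ∈ D ∧ x.2.2 ∈ eInterval (lo x.1) (up x.1)}) =
      (∫⁻ r, D.indicator (fun r => gaussianReal μ₂ v₂ (eInterval (lo r) (up r))) r ∂ν) *
        (volume : Measure ℝ).restrict (Set.Ioo 0 1) S := by
    intro S hS
    rw [Measure.prod_apply ((hf hS).inter hT), ← lintegral_mul_const _ hmeas]
    exact lintegral_congr fun r => hsec hS r
  -- Taking `S = univ` identifies the integral of the weights as the mass of the truncation event.
  have htot := hval MeasurableSet.univ
  rw [Set.preimage_univ, Set.univ_inter, Measure.restrict_apply_univ, Real.volume_Ioo, sub_zero,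
    ENNReal.ofReal_one, mul_one] at htot
  ext S hS
  rw [Measure.map_apply hf hS, Measure.restrict_apply (hf hS), hval hS, htot, Measure.smul_apply,
    smul_eq_mul]

/-- On a fibre with `up ≤ lo` the event forces the second Gaussian into a null interval. -/
lemma ae_restrict_prod_lower_lt_upper (hv₂ : v₂ ≠ 0) (μ₁ μ₂ : ℝ)
    (hlo : Measurable lo) (hup : Measurable up) (hD : MeasurableSet D) :
    ∀ᵐ x ∂((ν.prod ((gaussianReal μ₁ v₁).prod (gaussianReal μ₂ v₂))).restrict
        {x | x.1 ∈ D ∧ x.2.2 ∈ eInterval (lo x.1) (up x.1)}), lo x.1 < up x.1 := by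
  have hT := measurableSet_truncEvent hlo hup hD
  have hlt : MeasurableSet {x : E × ℝ × ℝ | lo x.1 < up x.1} :=
    measurableSet_lt (by fun_prop) (by fun_prop)
  rw [ae_restrict_iff hlt, ae_iff]
  refine (Measure.measure_prod_null ?_).2 (ae_of_all _ fun r => ?_)
  · have : MeasurableSet ({x : E × ℝ × ℝ | x.1 ∈ D ∧ x.2.2 ∈ eInterval (lo x.1) (up x.1)} ∩
        {x : E × ℝ × ℝ | lo x.1 < up x.1}ᶜ) := hT.inter hlt.compl
    convert this using 1
    ext x
    simp [and_assoc]
  · rcases lt_or_ge (lo r) (up r) with h | h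
    · rw [Pi.zero_apply]
      convert measure_empty (μ := (gaussianReal μ₁ v₁).prod (gaussianReal μ₂ v₂))
      ext q
      simp [h]
    · refine measure_mono_null (t := Set.univ ×ˢ eInterval (lo r) (up r))
        (fun q hq => ⟨trivial, ?_⟩) ?_
      · simp only [Set.mem_preimage, Set.mem_ofPred_eq, Classical.not_imp] at hq
        exact hq.1.2
      · rw [Measure.prod_prod, gaussianReal_eInterval_eq_zero μ₂ hv₂ h, mul_zero]

end Core

/-! ### From a uniform p-value to exact inference -/

lemma restrict_Ioo_ne_zero : (volume : Measure ℝ).restrict (Set.Ioo 0 1) ≠ 0 := by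
  rw [ne_eq, Measure.restrict_eq_zero, Real.volume_Ioo]
  simp

lemma exactInference_cond {Ω : Type*} [MeasurableSpace Ω] {P : Measure Ω} [IsFiniteMeasure P]
    {s : Set Ω} (hs : P s ≠ 0) {F : EReal → EReal → ℝ → ℝ → ℝ} {T : Ω → ℝ} {lo up : Ω → EReal}
    {β : ℝ} (hlt : ∀ᵐ ω ∂(P.restrict s), lo ω < up ω)
    (hmap : (P.restrict s).map (fun ω => F (lo ω) (up ω) β (T ω)) =
      P s • (volume : Measure ℝ).restrict (Set.Ioo 0 1))
    (hanti : ∀ a b, a < b → ∀ z, StrictAnti fun μ => F a b μ z)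
    (hcont : ∀ a b, a < b → ∀ z, Continuous fun μ => F a b μ z)
    (hbot : ∀ a b, a < b → ∀ z, Tendsto (fun μ => F a b μ z) atBot (𝓝 1))
    (htop : ∀ a b, a < b → ∀ z, Tendsto (fun μ => F a b μ z) atTop (𝓝 0)) :
    ExactInference (cond P s) F T lo up β := by
  have hQlt : ∀ᵐ ω ∂(cond P s), lo ω < up ω := Measure.ae_smul_measure hlt _
  have hQmap : (cond P s).map (fun ω => F (lo ω) (up ω) β (T ω)) =
      (volume : Measure ℝ).restrict (Set.Ioo 0 1) := by
    rw [ProbabilityTheory.cond, Measure.map_smul, hmap, smul_smul,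
      ENNReal.inv_mul_cancel hs (measure_ne_top _ _), one_smul]
  -- A function that is not a.e. measurable has zero pushforward, so the nonzero image law yields
  -- measurability for free.
  have hfm : AEMeasurable (fun ω => F (lo ω) (up ω) β (T ω)) (cond P s) :=
    AEMeasurable.of_map_ne_zero (hQmap ▸ restrict_Ioo_ne_zero)
  refine ⟨hQlt, ?_, fun α hα => ?_⟩
  · rw [pdf.IsUniform, hQmap, ProbabilityTheory.cond, Real.volume_Ioo]
    simp
  · have hae : {ω | β ∈ Set.Icc (ciLower (fun μ => F (lo ω) (up ω) μ (T ω)) α)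
        (ciUpper (fun μ => F (lo ω) (up ω) μ (T ω)) α)} =ᵐ[cond P s]
        (fun ω => F (lo ω) (up ω) β (T ω)) ⁻¹' Set.Icc (α / 2) (1 - α / 2) := by
      filter_upwards [hQlt] with ω hω
      exact propext (mem_Icc_ci_iff (hanti _ _ hω (T ω)) (hcont _ _ hω (T ω))
        (hbot _ _ hω (T ω)) (htop _ _ hω (T ω)) hα β)
    have hsub : Set.Icc (α / 2) (1 - α / 2) ⊆ Set.Ioo (0 : ℝ) 1 := fun x hx =>
      ⟨by linarith [hx.1, hα.1], by linarith [hx.2, hα.1]⟩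
    rw [measure_congr hae, ← Measure.map_apply_of_aemeasurable hfm measurableSet_Icc, hQmap,
      Measure.restrict_apply measurableSet_Icc, Set.inter_eq_self_of_subset_left hsub,
      Real.volume_Icc]
    congr 1
    ring

/-! ### Polyhedra as truncation events -/

section Geometry

variable {S : Type*} [Fintype S] {η : S → ℝ} {m : ℕ}

lemma dotProduct_direction (hη : η ⬝ᵥ η ≠ 0) : η ⬝ᵥ direction η = 1 := by
  rw [direction, dotProduct_smul, smul_eq_mul, inv_mul_cancel₀ hη]

lemma dotProduct_residual (hη : η ⬝ᵥ η ≠ 0) (u : S → ℝ) : η ⬝ᵥ residual η u = 0 := by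
  rw [residual, dotProduct_sub, dotProduct_smul, dotProduct_direction hη, smul_eq_mul, mul_one,
    sub_self]

lemma residual_residual (hη : η ⬝ᵥ η ≠ 0) (u : S → ℝ) :
    residual η (residual η u) = residual η u := by
  rw [residual, dotProduct_residual hη, zero_smul, sub_zero]

lemma mulVec_eq_residual_add (A : Matrix (Fin m) S ℝ) (u : S → ℝ) (i : Fin m) :
    (A *ᵥ u) i = (A *ᵥ residual η u) i + (η ⬝ᵥ u) * (A *ᵥ direction η) i := by
  conv_lhs => rw [show u = residual η u + (η ⬝ᵥ u) • direction η by simp [residual]]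
  rw [Matrix.mulVec_add, Matrix.mulVec_smul]
  rfl

/-- The truncation points are functions of the residual alone, hence independent of the contrast
they truncate. -/
lemma truncLower_residual (hη : η ⬝ᵥ η ≠ 0) (A : Matrix (Fin m) S ℝ) (b : Fin m → ℝ) (u : S → ℝ) :
    truncLower η A b (residual η u) = truncLower η A b u := by
  simp only [truncLower, residual_residual hη]

lemma truncUpper_residual (hη : η ⬝ᵥ η ≠ 0) (A : Matrix (Fin m) S ℝ) (b : Fin m → ℝ) (u : S → ℝ) :
    truncUpper η A b (residual η u) = truncUpper η A b u := by
  simp only [truncUpper, residual_residual hη]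

/-- The residuals that satisfy the constraints on which moving along `η` has no effect. -/
def freeConstraints (η : S → ℝ) (A : Matrix (Fin m) S ℝ) (b : Fin m → ℝ) : Set (S → ℝ) :=
  {r | ∀ i, (A *ᵥ direction η) i = 0 → (A *ᵥ r) i ≤ b i}

/-- Substituting `u = r + c ηᵀu` turns constraint `i` into `(A r)_i + ηᵀu (A c)_i ≤ b_i`. Solving
for `ηᵀu` gives a lower bound, an upper bound or a condition on `r`, according to the sign of `(A
c)_i`. -/
lemma mem_polyhedron_iff (A : Matrix (Fin m) S ℝ) (b : Fin m → ℝ) (u : S → ℝ) :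
    u ∈ polyhedron A b ↔ residual η u ∈ freeConstraints η A b ∧
      η ⬝ᵥ u ∈ eInterval (truncLower η A b u) (truncUpper η A b u) := by
  change (∀ i, (A *ᵥ u) i ≤ b i) ↔
    (∀ i, (A *ᵥ direction η) i = 0 → (A *ᵥ residual η u) i ≤ b i) ∧
      truncLower η A b u ≤ ((η ⬝ᵥ u : ℝ) : EReal) ∧ ((η ⬝ᵥ u : ℝ) : EReal) ≤ truncUpper η A b u
  simp only [truncLower, truncUpper, iSup_le_iff, le_iInf_iff, EReal.coe_le_coe_iff]
  simp only [mulVec_eq_residual_add (η := η) A u]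
  constructor
  · intro h
    refine ⟨fun i hi => ?_, fun i hi => ?_, fun i hi => ?_⟩
    · have := h i
      rwa [hi, mul_zero, add_zero] at this
    · rw [div_le_iff_of_neg hi]; linarith [h i]
    · rw [le_div_iff₀ hi]; linarith [h i]
  · rintro ⟨h0, hl, hu⟩ i
    rcases lt_trichotomy ((A *ᵥ direction η) i) 0 with hi | hi | hi
    · have := hl i hi
      rw [div_le_iff_of_neg hi] at this
      linarith
    · rw [hi, mul_zero, add_zero]; exact h0 i hi
    · have := hu i hi
      rw [le_div_iff₀ hi] at this
      linarith

lemma measurable_mulVec_apply (A : Matrix (Fin m) S ℝ) (i : Fin m) :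
    Measurable fun u : S → ℝ => (A *ᵥ u) i := by
  simp only [Matrix.mulVec, dotProduct]
  fun_prop

lemma measurable_dotProduct (η : S → ℝ) : Measurable fun u : S → ℝ => η ⬝ᵥ u := by
  simp only [dotProduct]
  fun_prop

lemma measurable_residual (η : S → ℝ) : Measurable (residual η) := by
  have h := measurable_dotProduct η
  refine measurable_pi_lambda _ fun i => ?_
  simp only [residual, Pi.sub_apply, Pi.smul_apply, smul_eq_mul]
  fun_prop

lemma measurableSet_polyhedron (A : Matrix (Fin m) S ℝ) (b : Fin m → ℝ) :
    MeasurableSet (polyhedron A b) := by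
  have : polyhedron A b = ⋂ i, {u | (A *ᵥ u) i ≤ b i} := by ext u; simp [polyhedron]
  rw [this]
  exact MeasurableSet.iInter fun i =>
    measurableSet_le (measurable_mulVec_apply A i) measurable_const

lemma measurableSet_freeConstraints (η : S → ℝ) (A : Matrix (Fin m) S ℝ) (b : Fin m → ℝ) :
    MeasurableSet (freeConstraints η A b) := by
  have : freeConstraints η A b =
      ⋂ i, ⋂ (_ : (A *ᵥ direction η) i = 0), {u | (A *ᵥ u) i ≤ b i} := by
    ext u; simp [freeConstraints]
  rw [this]
  exact MeasurableSet.iInter fun i => MeasurableSet.iInter fun _ =>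
    measurableSet_le (measurable_mulVec_apply A i) measurable_const

lemma measurable_truncPoint (η : S → ℝ) (A : Matrix (Fin m) S ℝ) (b : Fin m → ℝ) (i : Fin m) :
    Measurable fun u : S → ℝ =>
      (((b i - (A *ᵥ residual η u) i) / (A *ᵥ direction η) i : ℝ) : EReal) := by
  have := (measurable_mulVec_apply A i).comp (measurable_residual η)
  exact measurable_coe_real_ereal.comp ((measurable_const.sub this).div_const _)

lemma measurable_truncLower (η : S → ℝ) (A : Matrix (Fin m) S ℝ) (b : Fin m → ℝ) :
    Measurable (truncLower η A b) :=
  Measurable.iSup fun i => Measurable.iSup_Prop _ (measurable_truncPoint η A b i)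

lemma measurable_truncUpper (η : S → ℝ) (A : Matrix (Fin m) S ℝ) (b : Fin m → ℝ) :
    Measurable (truncUpper η A b) :=
  Measurable.iInf fun i => Measurable.iInf_Prop _ (measurable_truncPoint η A b i)

end Geometry

/-! ### Linear contrasts of a Gaussian vector with independent coordinates -/

section GaussianVector

variable {Ω : Type*} [MeasurableSpace Ω] {P : Measure Ω}
  {S : Type*} [Fintype S] {u : Ω → S → ℝ} {g : S → ℝ} {v : ℝ≥0}

/-- Transfers the Lebesgue null sets in the description of the selection event to null sets of the
law of `y_A`. -/
lemma pi_gaussianReal_absolutelyContinuous (g : S → ℝ) (hv : v ≠ 0) :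
    Measure.pi (fun i => gaussianReal (g i) v) ≪ (volume : Measure (S → ℝ)) := by
  have heq : Measure.pi (fun i => gaussianReal (g i) v) = (volume : Measure (S → ℝ)).withDensity
      (fun x => ENNReal.ofReal (∏ i, gaussianPDFReal (g i) v (x i))) := by
    refine Measure.pi_eq fun s hs => ?_
    rw [withDensity_apply _ (MeasurableSet.univ_pi hs), volume_pi, Measure.restrict_pi_pi,
      ← ofReal_integral_eq_lintegral_ofReal, integral_fintype_prod_eq_prod,
      ENNReal.ofReal_prod_of_nonneg fun i _ =>
        integral_nonneg fun x => gaussianPDFReal_nonneg _ _ _]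
    · exact Finset.prod_congr rfl fun i _ => (gaussianReal_apply_eq_integral _ hv _).symm
    · exact Integrable.fintype_prod_dep fun i => (integrable_gaussianPDFReal _ _).restrict
    · exact ae_of_all _ fun x => Finset.prod_nonneg fun i _ => gaussianPDFReal_nonneg _ _ _
  rw [heq]
  exact withDensity_absolutelyContinuous _ _

lemma hasLaw_eval_of_pi (hu : HasLaw u (Measure.pi fun i => gaussianReal (g i) v) P) (i : S) :
    HasLaw (fun ω => u ω i) (gaussianReal (g i) v) P :=
  (measurePreserving_eval (fun i => gaussianReal (g i) v) i).fun_comp_hasLaw hu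

lemma memLp_eval_of_pi (hu : HasLaw u (Measure.pi fun i => gaussianReal (g i) v) P) (i : S) :
    MemLp (fun ω => u ω i) 2 P :=
  (hasLaw_eval_of_pi hu i).hasGaussianLaw.memLp_two

variable [IsProbabilityMeasure P]

lemma iIndepFun_eval_of_pi (hu : HasLaw u (Measure.pi fun i => gaussianReal (g i) v) P) :
    iIndepFun (fun i ω => u ω i) P :=
  (iIndepFun_iff_hasLaw_pi_pi (hasLaw_eval_of_pi hu)).2 hu

lemma covariance_dotProduct (hu : HasLaw u (Measure.pi fun i => gaussianReal (g i) v) P)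
    (η ζ : S → ℝ) : cov[fun ω => η ⬝ᵥ u ω, fun ω => ζ ⬝ᵥ u ω; P] = v * (η ⬝ᵥ ζ) := by
  classical
  have hL := memLp_eval_of_pi hu
  have hcov : ∀ i j, cov[fun ω => u ω i, fun ω => u ω j; P] = if i = j then (v : ℝ) else 0 := by
    intro i j
    split_ifs with h
    · subst h
      rw [covariance_self (hasLaw_eval_of_pi hu i).aemeasurable,
        (hasLaw_eval_of_pi hu i).variance_eq, variance_id_gaussianReal]
    · exact ((iIndepFun_eval_of_pi hu).indepFun h).covariance_eq_zero (hL i) (hL j)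
  simp only [dotProduct]
  rw [covariance_fun_sum_fun_sum (fun i => (hL i).const_mul _) (fun i => (hL i).const_mul _)]
  simp only [covariance_const_mul_left, covariance_const_mul_right, hcov, mul_ite, mul_zero,
    Finset.sum_ite_eq, Finset.mem_univ, if_true, Finset.mul_sum]
  exact Finset.sum_congr rfl fun i _ => by ring

lemma integral_dotProduct (hu : HasLaw u (Measure.pi fun i => gaussianReal (g i) v) P)
    (η : S → ℝ) : ∫ ω, η ⬝ᵥ u ω ∂P = η ⬝ᵥ g := by
  simp only [dotProduct]
  rw [integral_finsetSum _ fun i _ =>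
    ((memLp_eval_of_pi hu i).integrable one_le_two).const_mul (η i)]
  refine Finset.sum_congr rfl fun i _ => ?_
  rw [integral_const_mul, (hasLaw_eval_of_pi hu i).integral_eq, integral_id_gaussianReal]

lemma hasGaussianLaw_of_pi (hu : HasLaw u (Measure.pi fun i => gaussianReal (g i) v) P) :
    HasGaussianLaw u P :=
  (iIndepFun_eval_of_pi hu).hasGaussianLaw fun i => (hasLaw_eval_of_pi hu i).hasGaussianLaw

/-- The continuous linear form `u ↦ ηᵀ u`. -/
noncomputable def dotProductCLM (η : S → ℝ) : (S → ℝ) →L[ℝ] ℝ :=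
  LinearMap.toContinuousLinearMap (dotProductBilin ℝ ℝ η)

lemma hasLaw_dotProduct (hu : HasLaw u (Measure.pi fun i => gaussianReal (g i) v) P)
    (η : S → ℝ) : HasLaw (fun ω => η ⬝ᵥ u ω) (gaussianReal (η ⬝ᵥ g) (v * (η ⬝ᵥ η)).toNNReal) P := by
  have hG : HasGaussianLaw (fun ω => η ⬝ᵥ u ω) P := (hasGaussianLaw_of_pi hu).map (dotProductCLM η)
  refine ⟨hG.aemeasurable, ?_⟩
  rw [hG.map_eq_gaussianReal, integral_dotProduct hu, ← covariance_self hG.aemeasurable,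
    covariance_dotProduct hu]

lemma residual_apply_eq_dotProduct [DecidableEq S] (η w : S → ℝ) (k : S) :
    residual η w k = (Pi.single k 1 - direction η k • η) ⬝ᵥ w := by
  rw [sub_dotProduct, smul_dotProduct, single_one_dotProduct, residual, Pi.sub_apply,
    Pi.smul_apply, smul_eq_mul, smul_eq_mul, mul_comm]

/-- Both are linear images of one Gaussian vector, and the covariance of the `k`-th residual with
`ηᵀu` is `v (η_k - ‖η‖⁻² η_k ‖η‖²) = 0`. -/
lemma indepFun_residual_dotProduct (hu : HasLaw u (Measure.pi fun i => gaussianReal (g i) v) P)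
    {η : S → ℝ} (hη : η ⬝ᵥ η ≠ 0) :
    IndepFun (fun ω => residual η (u ω)) (fun ω => η ⬝ᵥ u ω) P := by
  classical
  -- The scalar contrast is viewed as a family over `Unit`, to match the covariance criterion for
  -- two Gaussian families.
  have hG : HasGaussianLaw
      (fun ω => ((fun k => residual η (u ω) k), fun _ : Unit => η ⬝ᵥ u ω)) P := by
    have hfun : (fun ω => ((fun k => residual η (u ω) k), fun _ : Unit => η ⬝ᵥ u ω)) =
        ((ContinuousLinearMap.pi fun k => dotProductCLM (Pi.single k 1 - direction η k • η)).prod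
          (ContinuousLinearMap.pi fun _ : Unit => dotProductCLM η)) ∘ u := by
      funext ω
      refine Prod.ext (funext fun k => ?_) rfl
      exact residual_apply_eq_dotProduct η (u ω) k
    rw [hfun]
    exact (hasGaussianLaw_of_pi hu).map _
  have hind := hG.indepFun_of_covariance_eval (X := fun k ω => residual η (u ω) k)
    (Y := fun (_ : Unit) ω => η ⬝ᵥ u ω) fun k _ => by
      simp only [residual_apply_eq_dotProduct]
      rw [covariance_dotProduct hu, sub_dotProduct, smul_dotProduct, single_one_dotProduct,
        direction, Pi.smul_apply, smul_eq_mul, smul_eq_mul, mul_right_comm, inv_mul_cancel₀ hη,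
        one_mul, sub_self, mul_zero]
  exact hind.comp measurable_id (measurable_pi_apply ())

end GaussianVector

/-! ### Least squares contrasts -/

section Contrast

variable {n p : ℕ} {X : Matrix (Fin n) (Fin p) ℝ} {S : Finset (Fin n)} {M : Finset (Fin p)}

/-- With `G` the Gram matrix, `(G⁻¹Xᵀ)(G⁻¹Xᵀ)ᵀ = G⁻¹ G G⁻¹ = G⁻¹`. This makes `coefVar` the variance
of the coefficient. -/
lemma contrast_dotProduct_contrast (h : IsUnit (gram X S M).det) (j : M) :
    contrast X S M j ⬝ᵥ contrast X S M j = (gram X S M)⁻¹ j j := by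
  have hT : ((gram X S M)⁻¹)ᵀ = (gram X S M)⁻¹ := by
    rw [Matrix.transpose_nonsing_inv]
    simp [gram, Matrix.transpose_mul]
  have h1 : contrast X S M j ⬝ᵥ contrast X S M j =
      (((gram X S M)⁻¹ * (subDesign X S M)ᵀ) * ((gram X S M)⁻¹ * (subDesign X S M)ᵀ)ᵀ) j j := rfl
  rw [h1, Matrix.transpose_mul, Matrix.transpose_transpose, hT, Matrix.mul_assoc,
    ← Matrix.mul_assoc (subDesign X S M)ᵀ]
  change ((gram X S M)⁻¹ * (gram X S M * (gram X S M)⁻¹)) j j = _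
  rw [Matrix.mul_nonsing_inv _ h, Matrix.mul_one]

/-- From `G⁻¹XᵀX = 1`, the contrast has inner product 1 with the `j`-th column, so it is not zero.
-/
lemma contrast_dotProduct_contrast_pos (h : IsUnit (gram X S M).det) (j : M) :
    0 < contrast X S M j ⬝ᵥ contrast X S M j := by
  have h0 : 0 ≤ contrast X S M j ⬝ᵥ contrast X S M j :=
    Finset.sum_nonneg fun i _ => mul_self_nonneg _
  refine h0.lt_of_ne' fun hz => ?_
  rw [dotProduct_self_eq_zero] at hz
  have h1 : ((gram X S M)⁻¹ * (subDesign X S M)ᵀ * subDesign X S M) j j =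
      contrast X S M j ⬝ᵥ fun i => subDesign X S M i j := rfl
  rw [hz, zero_dotProduct, Matrix.mul_assoc] at h1
  change ((gram X S M)⁻¹ * gram X S M) j j = 0 at h1
  rw [Matrix.nonsing_inv_mul _ h, Matrix.one_apply_eq] at h1
  exact one_ne_zero h1

lemma coefVar_eq (h : IsUnit (gram X S M).det) (j : M) (τ : ℝ) :
    coefVar X τ S M j = τ ^ 2 * (contrast X S M j ⬝ᵥ contrast X S M j) := by
  rw [coefVar, contrast_dotProduct_contrast h]

lemma coefVar_pos (h : IsUnit (gram X S M).det) (j : M) {τ : ℝ} (hτ : 0 < τ) :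
    0 < coefVar X τ S M j := by
  rw [coefVar_eq h]
  exact mul_pos (pow_pos hτ 2) (contrast_dotProduct_contrast_pos h j)

end Contrast

/-! ### The parts of the response -/

section Triple

variable {n p : ℕ} {X : Matrix (Fin n) (Fin p) ℝ} {SA SB : Finset (Fin n)} {M : Finset (Fin p)}
  {j : M}

/-- The residual of `y_A`, the contrast of `y_B` and the contrast of `y_A`. -/
noncomputable def carveTriple (X : Matrix (Fin n) (Fin p) ℝ) (SA SB : Finset (Fin n))
    (M : Finset (Fin p)) (j : M) (w : Fin n → ℝ) : (SA → ℝ) × ℝ × ℝ :=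
  (residual (contrast X SA M j) (SA.restrict w), olsCoef X SB M j w, olsCoef X SA M j w)

lemma preimage_carveTriple {Ω : Type*} (y : Ω → Fin n → ℝ) (hA : IsUnit (gram X SA M).det)
    {m : ℕ} (A : Matrix (Fin m) SA ℝ) (b : Fin m → ℝ) :
    {ω | SA.restrict (y ω) ∈ polyhedron A b} = (fun ω => carveTriple X SA SB M j (y ω)) ⁻¹'
      {x | x.1 ∈ freeConstraints (contrast X SA M j) A b ∧
        x.2.2 ∈ eInterval (truncLower (contrast X SA M j) A b x.1)
          (truncUpper (contrast X SA M j) A b x.1)} := by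
  have hη := (contrast_dotProduct_contrast_pos hA j).ne'
  ext ω
  simp only [Set.mem_preimage, Set.mem_ofPred_eq, carveTriple, truncLower_residual hη,
    truncUpper_residual hη]
  exact mem_polyhedron_iff A b _

lemma carveEstimator_eq (w : Fin n → ℝ) :
    carveEstimator X SA SB M j w =
      (SB.card : ℝ) / n * olsCoef X SB M j w + (SA.card : ℝ) / n * olsCoef X SA M j w := by
  rw [carveEstimator]
  ring

end Triple

section Parts

variable {Ω : Type*} [MeasurableSpace Ω] {P : Measure Ω} [IsProbabilityMeasure P]
  {n p : ℕ} {X : Matrix (Fin n) (Fin p) ℝ} {g : Fin n → ℝ} {τ : ℝ} {y : Ω → Fin n → ℝ}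
  {S SA SB : Finset (Fin n)} {M : Finset (Fin p)} {j : M}

lemma hasLaw_restrict {v : ℝ≥0} (hy : HasLaw y (Measure.pi fun i => gaussianReal (g i) v) P)
    (S : Finset (Fin n)) :
    HasLaw (fun ω => S.restrict (y ω)) (Measure.pi fun i : S => gaussianReal (g i) v) P :=
  ((iIndepFun_eval_of_pi hy).precomp Subtype.val_injective).hasLaw_pi
    fun i : S => hasLaw_eval_of_pi hy i

lemma indepFun_restrict {v : ℝ≥0} (hy : HasLaw y (Measure.pi fun i => gaussianReal (g i) v) P)
    (hdisj : Disjoint SA SB) :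
    IndepFun (fun ω => SA.restrict (y ω)) (fun ω => SB.restrict (y ω)) P :=
  (iIndepFun_eval_of_pi hy).indepFun_finset₀ SA SB hdisj
    fun i => (hasLaw_eval_of_pi hy i).aemeasurable

lemma hasLaw_olsCoef (hy : HasLaw y (Measure.pi fun i => gaussianReal (g i) (τ ^ 2).toNNReal) P)
    (h : IsUnit (gram X S M).det) :
    HasLaw (fun ω => olsCoef X S M j (y ω))
      (gaussianReal (olsCoef X S M j g) (coefVar X τ S M j).toNNReal) P := by
  have := hasLaw_dotProduct (hasLaw_restrict hy S) (contrast X S M j)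
  rwa [Real.coe_toNNReal _ (sq_nonneg τ), ← coefVar_eq h] at this

/-- Residual and contrast of part A are independent by orthogonality; both are independent of part B
because the index sets are disjoint. -/
lemma hasLaw_carveTriple
    (hy : HasLaw y (Measure.pi fun i => gaussianReal (g i) (τ ^ 2).toNNReal) P)
    (hdisj : Disjoint SA SB) (hA : IsUnit (gram X SA M).det) (hB : IsUnit (gram X SB M).det) :
    HasLaw (fun ω => carveTriple X SA SB M j (y ω))
      ((P.map fun ω => residual (contrast X SA M j) (SA.restrict (y ω))).prod
        ((gaussianReal (olsCoef X SB M j g) (coefVar X τ SB M j).toNNReal).prod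
          (gaussianReal (olsCoef X SA M j g) (coefVar X τ SA M j).toNNReal))) P := by
  have hyA := hasLaw_restrict hy SA
  have hRm : AEMeasurable (fun ω => residual (contrast X SA M j) (SA.restrict (y ω))) P :=
    (measurable_residual _).comp_aemeasurable hyA.aemeasurable
  have hR : HasLaw (fun ω => residual (contrast X SA M j) (SA.restrict (y ω)))
      (P.map fun ω => residual (contrast X SA M j) (SA.restrict (y ω))) P := ⟨hRm, rfl⟩
  have : IsProbabilityMeasure (P.map fun ω => residual (contrast X SA M j) (SA.restrict (y ω))) :=
    Measure.isProbabilityMeasure_map hRm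
  have h1 := (indepFun_residual_dotProduct hyA
    (contrast_dotProduct_contrast_pos hA j).ne').hasLaw_prod hR (hasLaw_olsCoef (j := j) hy hA)
  have hind : IndepFun
      (fun ω => (residual (contrast X SA M j) (SA.restrict (y ω)), olsCoef X SA M j (y ω)))
      (fun ω => olsCoef X SB M j (y ω)) P :=
    (indepFun_restrict hy hdisj).comp
      ((measurable_residual (contrast X SA M j)).prodMk (measurable_dotProduct (contrast X SA M j)))
      (measurable_dotProduct (contrast X SB M j))
  have h2 := hind.hasLaw_prod h1 (hasLaw_olsCoef (j := j) hy hB)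
  -- Reorders `((r, a), b)` into `(r, (b, a))`.
  exact (((MeasurePreserving.id _).prod Measure.measurePreserving_swap).comp
    (measurePreserving_prodAssoc _ _ _)).fun_comp_hasLaw h2

lemma map_carveCDF_restrict_polyhedron (hτ : 0 < τ)
    (hy : HasLaw y (Measure.pi fun i => gaussianReal (g i) (τ ^ 2).toNNReal) P)
    (hn : 0 < (SB.card : ℝ) / n) (hdisj : Disjoint SA SB) (hA : IsUnit (gram X SA M).det)
    (hB : IsUnit (gram X SB M).det) {β : ℝ} (hβA : olsCoef X SA M j g = β)
    (hβB : olsCoef X SB M j g = β) {m : ℕ} (A : Matrix (Fin m) SA ℝ) (b : Fin m → ℝ) :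
    (P.restrict {ω | SA.restrict (y ω) ∈ polyhedron A b}).map
      (fun ω => carveCDF X τ SA SB M j
        (truncLower (contrast X SA M j) A b (SA.restrict (y ω)))
        (truncUpper (contrast X SA M j) A b (SA.restrict (y ω))) β
        (carveEstimator X SA SB M j (y ω))) =
      P {ω | SA.restrict (y ω) ∈ polyhedron A b} •
        (volume : Measure ℝ).restrict (Set.Ioo 0 1) := by
  have hη := (contrast_dotProduct_contrast_pos hA j).ne'
  have hZ := hasLaw_carveTriple (j := j) hy hdisj hA hB
  have hlo := measurable_truncLower (contrast X SA M j) A b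
  have hup := measurable_truncUpper (contrast X SA M j) A b
  have hD := measurableSet_freeConstraints (contrast X SA M j) A b
  have hT := measurableSet_truncEvent hlo hup hD
  have hlin : Measurable fun x : (SA → ℝ) × ℝ × ℝ =>
    (SB.card : ℝ) / n * x.2.1 + (SA.card : ℝ) / n * x.2.2 := by fun_prop
  have hf := measurable_sntnCDF_comp (hlo.comp (measurable_fst (β := ℝ × ℝ)))
    (hup.comp measurable_fst) hlin β β (coefVar X τ SB M j).toNNReal
    (coefVar X τ SA M j).toNNReal ((SB.card : ℝ) / n) ((SA.card : ℝ) / n)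
  simp only [Function.comp_apply] at hf
  have hcore := map_sntnCDF_restrict_prod
    (ν := P.map fun ω => residual (contrast X SA M j) (SA.restrict (y ω)))
    (Real.toNNReal_pos.2 (coefVar_pos hB j hτ)).ne' (Real.toNNReal_pos.2 (coefVar_pos hA j hτ)).ne'
    hn ((SA.card : ℝ) / n) β β hlo hup hD
  rw [hβA, hβB] at hZ
  rw [← hZ.map_eq, Measure.restrict_map_of_aemeasurable hZ.aemeasurable hT,
    AEMeasurable.map_map_of_aemeasurable hf.aemeasurable hZ.aemeasurable.restrict,
    Measure.map_apply_of_aemeasurable hZ.aemeasurable hT,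
    ← preimage_carveTriple y (SB := SB) (j := j) hA A b] at hcore
  rw [← hcore]
  congr 1
  funext ω
  simp only [carveCDF, carveEstimator_eq, Function.comp_apply, carveTriple,
    truncLower_residual hη, truncUpper_residual hη]

lemma ae_restrict_polyhedron_lower_lt_upper (hτ : 0 < τ)
    (hy : HasLaw y (Measure.pi fun i => gaussianReal (g i) (τ ^ 2).toNNReal) P)
    (hdisj : Disjoint SA SB) (hA : IsUnit (gram X SA M).det)
    (hB : IsUnit (gram X SB M).det) {m : ℕ} (A : Matrix (Fin m) SA ℝ) (b : Fin m → ℝ) :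
    ∀ᵐ ω ∂(P.restrict {ω | SA.restrict (y ω) ∈ polyhedron A b}),
      truncLower (contrast X SA M j) A b (SA.restrict (y ω)) <
        truncUpper (contrast X SA M j) A b (SA.restrict (y ω)) := by
  have hη := (contrast_dotProduct_contrast_pos hA j).ne'
  have hZ := hasLaw_carveTriple (j := j) hy hdisj hA hB
  have hlo := measurable_truncLower (contrast X SA M j) A b
  have hup := measurable_truncUpper (contrast X SA M j) A b
  have hD := measurableSet_freeConstraints (contrast X SA M j) A b
  have hT := measurableSet_truncEvent hlo hup hD
  have hcore := ae_restrict_prod_lower_lt_upper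
    (ν := P.map fun ω => residual (contrast X SA M j) (SA.restrict (y ω)))
    (v₁ := (coefVar X τ SB M j).toNNReal)
    (Real.toNNReal_pos.2 (coefVar_pos hA j hτ)).ne' (olsCoef X SB M j g) (olsCoef X SA M j g)
    hlo hup hD
  rw [← hZ.map_eq, Measure.restrict_map_of_aemeasurable hZ.aemeasurable hT,
    ← preimage_carveTriple y (SB := SB) (j := j) hA A b] at hcore
  filter_upwards [ae_of_ae_map hZ.aemeasurable.restrict hcore] with ω hω
  simpa only [carveTriple, truncLower_residual hη, truncUpper_residual hη] using hω

end Parts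

/-! ### Combining disjoint selection events -/

/-- A mixture of copies of one law `U` is again `U`, whatever the weights. On each piece `f` need
only agree a.e. with a function whose law is known. -/
lemma map_restrict_eq_smul_of_ae_eq_iUnion {Ω ι : Type*} [MeasurableSpace Ω] [Countable ι]
    {P : Measure Ω} {E : Set Ω} {s : ι → Set Ω} (hE : E =ᵐ[P] ⋃ i, s i)
    (hs : ∀ i, NullMeasurableSet (s i) P) (hd : Pairwise fun i k => AEDisjoint P (s i) (s k))
    {f : Ω → ℝ} {h : ι → Ω → ℝ} (hf : ∀ i, f =ᵐ[P.restrict (s i)] h i) {U : Measure ℝ}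
    (hU : U ≠ 0) (hmap : ∀ i, (P.restrict (s i)).map (h i) = P (s i) • U) :
    (P.restrict E).map f = P E • U := by
  have hm : ∀ i, AEMeasurable f (P.restrict (s i)) := fun i => by
    refine AEMeasurable.congr (f := h i) ?_ (hf i).symm
    by_cases h0 : P (s i) = 0
    · rw [Measure.restrict_eq_zero.2 h0]
      exact aemeasurable_zero_measure
    · refine AEMeasurable.of_map_ne_zero ?_
      rw [hmap i]
      intro hz
      refine hU ?_
      rw [← Measure.measure_univ_eq_zero] at hz ⊢
      simpa [h0] using hz
  have hsum : P.restrict (⋃ i, s i) = Measure.sum fun i => P.restrict (s i) :=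
    Measure.restrict_iUnion_ae hd hs
  rw [Measure.restrict_congr_set hE, measure_congr hE, hsum,
    Measure.map_sum (hsum ▸ aemeasurable_iUnion_iff.2 hm), measure_iUnion₀ hd hs]
  ext t ht
  rw [Measure.sum_apply _ ht, Measure.smul_apply, smul_eq_mul, ← ENNReal.tsum_mul_right]
  refine tsum_congr fun i => ?_
  rw [Measure.map_congr (hf i), hmap i, Measure.smul_apply, smul_eq_mul]

section Selection

variable {Ω : Type*} [MeasurableSpace Ω] {P : Measure Ω} {S : Type*} [Fintype S]
  {u : Ω → S → ℝ} {ν : Measure (S → ℝ)}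

lemma preimage_ae_eq (hu : HasLaw u ν P) (hν : ν ≪ volume) {s t : Set (S → ℝ)}
    (hst : s =ᵐ[volume] t) : u ⁻¹' s =ᵐ[P] u ⁻¹' t := by
  have h := hν.ae_eq hst
  rw [← hu.map_eq] at h
  exact ae_of_ae_map hu.aemeasurable h

lemma aedisjoint_preimage (hu : HasLaw u ν P) (hν : ν ≪ volume) {s t : Set (S → ℝ)}
    (hst : AEDisjoint volume s t) : AEDisjoint P (u ⁻¹' s) (u ⁻¹' t) := by
  have h : ν (s ∩ t) = 0 := hν hst
  rw [← hu.map_eq] at h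
  rw [AEDisjoint, ← Set.preimage_inter]
  exact Measure.preimage_null_of_map_null hu.aemeasurable h

/-- Two pieces meet in a null set and there are countably many, so almost every point of a piece
lies in no other. Any choice of index, measurable or not, is then forced. -/
lemma ae_restrict_index_eq {ι : Type*} [Countable ι] {s : ι → Set Ω}
    (hs : ∀ i, NullMeasurableSet (s i) P) (hd : Pairwise fun i k => AEDisjoint P (s i) (s k))
    {k : Ω → ι} (hk : ∀ i, ∀ ω ∈ s i, ω ∈ s (k ω)) (i : ι) :
    ∀ᵐ ω ∂(P.restrict (s i)), k ω = i := by
  have hne : ∀ᵐ ω ∂P, ∀ l, l ≠ i → ω ∉ s i ∩ s l := by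
    rw [ae_all_iff]
    intro l
    by_cases hl : l = i
    · exact ae_of_all _ fun _ h => absurd hl h
    · filter_upwards [measure_eq_zero_iff_ae_notMem.1 (hd (Ne.symm hl))] with ω hω _ using hω
  rw [ae_restrict_iff'₀ (hs i)]
  filter_upwards [hne] with ω hω hi
  by_contra h
  exact hω _ h ⟨hi, hk i ω hi⟩

end Selection

/-! ### The distribution function of data carving -/

section CarveCDF

variable {n p : ℕ} {X : Matrix (Fin n) (Fin p) ℝ} {τ : ℝ} {SA SB : Finset (Fin n)}
  {M : Finset (Fin p)} {j : M}

lemma card_div_pos {S : Finset (Fin n)} (hS : S.Nonempty) : 0 < (S.card : ℝ) / n := by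
  obtain ⟨i, -⟩ := id hS
  exact div_pos (Nat.cast_pos.2 hS.card_pos) (Nat.cast_pos.2 i.pos)

lemma card_div_add_card_div (hA : SA.Nonempty) (hdisj : Disjoint SA SB)
    (hcover : SA ∪ SB = Finset.univ) : (SB.card : ℝ) / n + (SA.card : ℝ) / n = 1 := by
  obtain ⟨i, -⟩ := id hA
  have hn : (n : ℝ) ≠ 0 := Nat.cast_ne_zero.2 i.pos.ne'
  have hcard : SA.card + SB.card = n := by
    rw [← Finset.card_union_of_disjoint hdisj, hcover, Finset.card_univ, Fintype.card_fin]
  rw [← add_div, div_eq_one_iff_eq hn]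
  exact_mod_cast (add_comm _ _).trans hcard

lemma carveCDF_eq_bivariateNormalCDF (hτ : 0 < τ) (hA : SA.Nonempty) (hB : SB.Nonempty)
    (hdisj : Disjoint SA SB) (hcover : SA ∪ SB = Finset.univ)
    (hgramA : IsUnit (gram X SA M).det) (hgramB : IsUnit (gram X SB M).det)
    {a b : EReal} (hab : a < b) (μ z : ℝ) {σ₁ ρ : ℝ}
    (hσ₁ : σ₁ = √(((SB.card : ℝ) ^ 2 * coefVar X τ SB M j
      + (SA.card : ℝ) ^ 2 * coefVar X τ SA M j) / (n : ℝ) ^ 2))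
    (hρ : ρ = (SA.card : ℝ) / n * √(coefVar X τ SA M j) / σ₁) :
    carveCDF X τ SA SB M j a b μ z =
      (bivariateNormalCDF ρ ((z - μ) / σ₁)
          ((b - (μ : EReal)) / (√(coefVar X τ SA M j) : EReal))
        - bivariateNormalCDF ρ ((z - μ) / σ₁)
          ((a - (μ : EReal)) / (√(coefVar X τ SA M j) : EReal)))
      / (stdNormalCDF ((b - (μ : EReal)) / (√(coefVar X τ SA M j) : EReal))
        - stdNormalCDF ((a - (μ : EReal)) / (√(coefVar X τ SA M j) : EReal))) := by
  have hσ : σ₁ = √(((SB.card : ℝ) / n) ^ 2 * coefVar X τ SB M j +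
      ((SA.card : ℝ) / n) ^ 2 * coefVar X τ SA M j) := by
    rw [hσ₁]
    congr 1
    ring
  have h := sntnCDF_eq_bivariateNormalCDF (coefVar_pos hgramB j hτ) (coefVar_pos hgramA j hτ)
    (card_div_pos hB) hab μ z hσ hρ
  -- The weights sum to one, so the centring `μ (c₁ + c₂)` is `μ`.
  rwa [card_div_add_card_div hA hdisj hcover, mul_one] at h

lemma strictAnti_carveCDF (hτ : 0 < τ) (hB : SB.Nonempty) (hgramA : IsUnit (gram X SA M).det)
    (hgramB : IsUnit (gram X SB M).det) {a b : EReal} (hab : a < b) (z : ℝ) :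
    StrictAnti fun μ => carveCDF X τ SA SB M j a b μ z :=
  sntnCDF_strictAnti (Real.toNNReal_pos.2 (coefVar_pos hgramB j hτ)).ne'
    (Real.toNNReal_pos.2 (coefVar_pos hgramA j hτ)).ne' (card_div_pos hB) (by positivity) hab z

lemma continuous_carveCDF (hτ : 0 < τ) (hB : SB.Nonempty) (hgramA : IsUnit (gram X SA M).det)
    (hgramB : IsUnit (gram X SB M).det) {a b : EReal} (hab : a < b) (z : ℝ) :
    Continuous fun μ => carveCDF X τ SA SB M j a b μ z :=
  continuous_sntnCDF_mean (Real.toNNReal_pos.2 (coefVar_pos hgramB j hτ)).ne'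
    (Real.toNNReal_pos.2 (coefVar_pos hgramA j hτ)).ne' (card_div_pos hB) (by positivity) hab z

lemma tendsto_carveCDF_atBot (hτ : 0 < τ) (hB : SB.Nonempty) (hgramA : IsUnit (gram X SA M).det)
    {a b : EReal} (hab : a < b) (z : ℝ) :
    Tendsto (fun μ => carveCDF X τ SA SB M j a b μ z) atBot (𝓝 1) :=
  tendsto_sntnCDF_mean_atBot (Real.toNNReal_pos.2 (coefVar_pos hgramA j hτ)).ne'
    (card_div_pos hB) (by positivity) hab z

lemma tendsto_carveCDF_atTop (hτ : 0 < τ) (hB : SB.Nonempty) (hgramA : IsUnit (gram X SA M).det)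
    {a b : EReal} (hab : a < b) (z : ℝ) :
    Tendsto (fun μ => carveCDF X τ SA SB M j a b μ z) atTop (𝓝 0) :=
  tendsto_sntnCDF_mean_atTop (Real.toNNReal_pos.2 (coefVar_pos hgramA j hτ)).ne'
    (card_div_pos hB) (by positivity) hab z

lemma exactInference_carveCDF {Ω : Type*} [MeasurableSpace Ω] {P : Measure Ω} [IsFiniteMeasure P]
    (hτ : 0 < τ) (hB : SB.Nonempty) (hgramA : IsUnit (gram X SA M).det)
    (hgramB : IsUnit (gram X SB M).det) {s : Set Ω} (hs : P s ≠ 0) {T : Ω → ℝ}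
    {lo up : Ω → EReal} {β : ℝ} (hlt : ∀ᵐ ω ∂(P.restrict s), lo ω < up ω)
    (hmap : (P.restrict s).map (fun ω => carveCDF X τ SA SB M j (lo ω) (up ω) β (T ω)) =
      P s • (volume : Measure ℝ).restrict (Set.Ioo 0 1)) :
    ExactInference (cond P s) (carveCDF X τ SA SB M j) T lo up β :=
  exactInference_cond hs hlt hmap
    (fun _ _ hab z => strictAnti_carveCDF hτ hB hgramA hgramB hab z)
    (fun _ _ hab z => continuous_carveCDF hτ hB hgramA hgramB hab z)
    (fun _ _ hab z => tendsto_carveCDF_atBot hτ hB hgramA hab z)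
    (fun _ _ hab z => tendsto_carveCDF_atTop hτ hB hgramA hab z)

end CarveCDF

end Carving

/-! ### Assembly of the theorem -/

theorem theorem1 {Ω : Type*} [MeasurableSpace Ω] (P : Measure Ω) [IsProbabilityMeasure P]
    {n p : ℕ} (X : Matrix (Fin n) (Fin p) ℝ) (g : Fin n → ℝ) (τ : ℝ) (hτ : 0 < τ)
    -- the response `y ∼ N(g, τ² Iₙ)`
    (y : Ω → Fin n → ℝ)
    (hy : HasLaw y (Measure.pi fun i => gaussianReal (g i) (τ ^ 2).toNNReal) P)
    -- the two parts of the data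
    (SA SB : Finset (Fin n)) (hA : SA.Nonempty) (hB : SB.Nonempty)
    (hdisj : Disjoint SA SB) (hcover : SA ∪ SB = Finset.univ)
    -- the selected model, the coefficient of interest, and well-posed regressions
    (M : Finset (Fin p)) (j : M)
    (hgramA : IsUnit (Carving.gram X SA M).det) (hgramB : IsUnit (Carving.gram X SB M).det)
    -- the selection algorithm, run on part A: selecting `M` is a union of polyhedra
    (Mhat : (SA → ℝ) → Finset (Fin p))
    {ι : Type*} [Countable ι] (m : ι → ℕ)
    (A : ∀ s, Matrix (Fin (m s)) SA ℝ) (b : ∀ s, Fin (m s) → ℝ)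
    (hsel : {u | Mhat u = M} =ᵐ[volume] ⋃ s, Carving.polyhedron (A s) (b s))
    -- the true parameter, the common value of the contrasts of the mean
    (β : ℝ) (hβA : Carving.olsCoef X SA M j g = β) (hβB : Carving.olsCoef X SB M j g = β) :
    -- exact inference given the polyhedron that contains `y_A`
    (∀ s, P {ω | SA.restrict (y ω) ∈ Carving.polyhedron (A s) (b s)} ≠ 0 →
      Carving.ExactInference
        (cond P {ω | SA.restrict (y ω) ∈ Carving.polyhedron (A s) (b s)})
        (Carving.carveCDF X τ SA SB M j)
        (fun ω => Carving.carveEstimator X SA SB M j (y ω))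
        (fun ω => Carving.truncLower (Carving.contrast X SA M j) (A s) (b s) (SA.restrict (y ω)))
        (fun ω => Carving.truncUpper (Carving.contrast X SA M j) (A s) (b s) (SA.restrict (y ω)))
        β) ∧
    -- exact inference given that `M` was selected, with the truncation points of the polyhedron
    -- `shat` that contains `y_A`
    (∀ shat : (SA → ℝ) → ι,
      (∀ u ∈ ⋃ s, Carving.polyhedron (A s) (b s),
        u ∈ Carving.polyhedron (A (shat u)) (b (shat u))) →
      Pairwise (fun s t => AEDisjoint volume
        (Carving.polyhedron (A s) (b s)) (Carving.polyhedron (A t) (b t))) →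
      P {ω | Mhat (SA.restrict (y ω)) = M} ≠ 0 →
      Carving.ExactInference
        (cond P {ω | Mhat (SA.restrict (y ω)) = M})
        (Carving.carveCDF X τ SA SB M j)
        (fun ω => Carving.carveEstimator X SA SB M j (y ω))
        (fun ω => Carving.truncLower (Carving.contrast X SA M j)
          (A (shat (SA.restrict (y ω)))) (b (shat (SA.restrict (y ω)))) (SA.restrict (y ω)))
        (fun ω => Carving.truncUpper (Carving.contrast X SA M j)
          (A (shat (SA.restrict (y ω)))) (b (shat (SA.restrict (y ω)))) (SA.restrict (y ω)))
        β) ∧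
    -- the CDF, its strict monotonicity in the common mean, and the roots
    (∀ a₁ b₁ : EReal, a₁ < b₁ → ∀ z : ℝ,
      (∀ μ : ℝ,
        let σ₁ := √(((SB.card : ℝ) ^ 2 * Carving.coefVar X τ SB M j
          + (SA.card : ℝ) ^ 2 * Carving.coefVar X τ SA M j) / (n : ℝ) ^ 2)
        let σ₂ := √(Carving.coefVar X τ SA M j)
        let ρ := (SA.card : ℝ) / n * σ₂ / σ₁
        let w : EReal := (a₁ - (μ : EReal)) / (σ₂ : EReal)
        let d : EReal := (b₁ - (μ : EReal)) / (σ₂ : EReal)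
        Carving.carveCDF X τ SA SB M j a₁ b₁ μ z =
          (Carving.bivariateNormalCDF ρ ((z - μ) / σ₁) d
            - Carving.bivariateNormalCDF ρ ((z - μ) / σ₁) w)
          / (Carving.stdNormalCDF d - Carving.stdNormalCDF w)) ∧
      StrictAnti (fun μ => Carving.carveCDF X τ SA SB M j a₁ b₁ μ z) ∧
      ∀ α ∈ Set.Ioo (0 : ℝ) 1,
        (∀ μ, Carving.carveCDF X τ SA SB M j a₁ b₁ μ z = 1 - α / 2 ↔
          μ = Carving.ciLower (fun μ' => Carving.carveCDF X τ SA SB M j a₁ b₁ μ' z) α) ∧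
        (∀ μ, Carving.carveCDF X τ SA SB M j a₁ b₁ μ z = α / 2 ↔
          μ = Carving.ciUpper (fun μ' => Carving.carveCDF X τ SA SB M j a₁ b₁ μ' z) α)) := by
  have hyA := Carving.hasLaw_restrict hy SA
  have hac := Carving.pi_gaussianReal_absolutelyContinuous (fun i : SA => g i)
    (Real.toNNReal_pos.2 (pow_pos hτ 2)).ne'
  have hmap := fun s => Carving.map_carveCDF_restrict_polyhedron hτ hy (Carving.card_div_pos hB)
    hdisj hgramA hgramB hβA hβB (A s) (b s)
  have hlt := fun s => Carving.ae_restrict_polyhedron_lower_lt_upper (j := j) hτ hy hdisj hgramA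
    hgramB (A s) (b s)
  refine ⟨fun s hs => Carving.exactInference_carveCDF hτ hB hgramA hgramB hs (hlt s) (hmap s),
    fun shat hshat hd hM => ?_, fun a₁ b₁ hab z => ⟨fun μ => ?_, ?_, fun α hα => ⟨fun μ => ?_,
      fun μ => ?_⟩⟩⟩
  -- `Mhat` is not assumed measurable; the selection event is handled through its a.e. equality with
  -- a union of polyhedral events.
  · have hE : {ω | Mhat (SA.restrict (y ω)) = M} =ᵐ[P]
        ⋃ s, {ω | SA.restrict (y ω) ∈ Carving.polyhedron (A s) (b s)} := by
      have h := Carving.preimage_ae_eq hyA hac hsel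
      rwa [Set.preimage_iUnion] at h
    have hnull : ∀ s, NullMeasurableSet
        {ω | SA.restrict (y ω) ∈ Carving.polyhedron (A s) (b s)} P := fun s =>
      hyA.aemeasurable.nullMeasurableSet_preimage (Carving.measurableSet_polyhedron (A s) (b s))
    have hdP : Pairwise fun s t => AEDisjoint P
        {ω | SA.restrict (y ω) ∈ Carving.polyhedron (A s) (b s)}
        {ω | SA.restrict (y ω) ∈ Carving.polyhedron (A t) (b t)} := fun s t hst =>
      Carving.aedisjoint_preimage hyA hac (hd hst)
    have hidx := Carving.ae_restrict_index_eq hnull hdP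
      (k := fun ω => shat (SA.restrict (y ω)))
      fun s ω hω => hshat _ (Set.mem_iUnion.2 ⟨s, hω⟩)
    refine Carving.exactInference_carveCDF hτ hB hgramA hgramB hM ?_
      (Carving.map_restrict_eq_smul_of_ae_eq_iUnion hE hnull hdP (fun s => ?_)
        Carving.restrict_Ioo_ne_zero hmap)
    · rw [Measure.restrict_congr_set hE, ae_restrict_iUnion_iff]
      intro s
      filter_upwards [hlt s, hidx s] with ω hω hs
      rwa [hs]
    · filter_upwards [hidx s] with ω hs
      rw [hs]
  · intro σ₁ σ₂ ρ w d
    exact Carving.carveCDF_eq_bivariateNormalCDF hτ hA hB hdisj hcover hgramA hgramB hab μ z rfl rfl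
  · exact Carving.strictAnti_carveCDF hτ hB hgramA hgramB hab z
  · have hanti := Carving.strictAnti_carveCDF (j := j) hτ hB hgramA hgramB hab z
    refine ⟨fun h => (Carving.ciLower_eq hanti h).symm, fun h => ?_⟩
    rw [h]
    exact Carving.map_ciLower hanti (Carving.continuous_carveCDF hτ hB hgramA hgramB hab z)
      (Carving.tendsto_carveCDF_atBot hτ hB hgramA hab z)
      (Carving.tendsto_carveCDF_atTop hτ hB hgramA hab z) hα
  · have hanti := Carving.strictAnti_carveCDF (j := j) hτ hB hgramA hgramB hab z
    refine ⟨fun h => (Carving.ciUpper_eq hanti h).symm, fun h => ?_⟩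
    rw [h]
    exact Carving.map_ciUpper hanti (Carving.continuous_carveCDF hτ hB hgramA hgramB hab z)
      (Carving.tendsto_carveCDF_atBot hτ hB hgramA hab z)
      (Carving.tendsto_carveCDF_atTop hτ hB hgramA hab z) hα
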